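/- Let $d\ge 1$. A measure $\mu$ on $\mathbb R^d$ is isotropic unimodal if $\mu=a\delta_0+f(x)\,dx$ with $a\ge 0$ and $f$ a finite, nonnegative, radial function that is radially nonincreasing on $\mathbb R^d\setminus\{0\}$. Let $\nu\neq 0$ be an isotropic unimodal L\'evy measure on $\mathbb R^d$, i.e. $\nu(\{0\})=0$ and $\int(|x|^2\wedge 1)\,\nu(dx)<\infty$, and denote its radial nonincreasing density on $\mathbb R^d\setminus\{0\}$ by $\nu(x)$. Let $$\psi(\xi)=\int_{\mathbb R^d}\bigl(1-\cos\langle\xi,x\rangle\bigr)\,\nu(dx),\qquad \xi\in\mathbb R^d,$$ and let $(p_t)_{t\ge 0}$ be the isotropic unimodal probability measures (the one-dimensional distributions of the pure-jump isotropic unimodal L\'evy process with L\'evy measure $\nu$) with $\int e^{i\langle\xi,x\rangle}p_t(dx)=e^{-t\psi(\xi)}$ for all $t\ge0$, $\xi\in\mathbb R^d$. As $\psi$ is radial, write $\psi(u)=\psi(\xi)$ for $|\xi|=u\ge 0$, and put $$\psi^*(u)=\sup_{0\le s\le u}\psi(s),\qquad \psi^-(u)=\inf\{s\ge 0:\ \psi^*(s)\ge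 u\},\qquad u\ge 0 .$$ Assume that $\psi$ satisfies the global weak lower and upper scaling conditions with exponents $\underline\alpha,\overline\alpha\in(0,2)$ and constants $\underline c\in(0,1]$, $\overline C\in[1,\infty)$: $$\underline c\,\lambda^{\underline\alpha}\psi(\theta)\ \le\ \psi(\lambda\theta)\ \le\ \overline C\,\lambda^{\overline\alpha}\psi(\theta)\qquad\text{for all }\lambda\ge 1,\ \theta>0 .$$ Then for every $t>0$ the measure $p_t$ has a continuous density $p_t(x)$ on $\mathbb R^d$, and for all $t>0$ and $x\in\mathbb R^d$, $$p_t(x)\ \approx\ \bigl[\psi^-(1/t)\bigr]^d\wedge\frac{t\,\psi^*(1/|x|)}{|x|^d}\ \approx\ p_t(0)\wedge[t\,\nu(x)],$$ where for $x=0$ the terms $t\psi^*(1/|x|)/|x|^d$ and $t\nu(x)$ are omitted, i.e. $p_t(0)\approx[\psi^-(1/t)]^d$. In particular, $$\nu(x)\ \approx\ \frac{\psi^*(1/|x|)}{|x|^d},\qquad x\in\mathbb R^d\setminus\{0\}.$$ Here $f\approx g$ means that $f,g\ge 0$ and $K^{-1}f\le g\le Kf$ for a constant $K\in(0,\infty)$,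 and $K$ depends only on $d,\underline\alpha,\underline c,\overline\alpha,\overline C$. -/

import Mathlib

open MeasureTheory
open scoped NNReal ENNReal

namespace UnimodalLevy

noncomputable section

/-- `ν` is a Lévy measure on `ℝ^d`: it is concentrated on `ℝ^d \ {0}` and
`∫ (|x|² ∧ 1) ν(dx) < ∞`. -/
def IsLevyMeasure {d : ℕ} (ν : Measure (EuclideanSpace ℝ (Fin d))) : Prop :=
  ν {0} = 0 ∧ ∫⁻ x, ENNReal.ofReal (min (‖x‖ ^ 2) 1) ∂ν < ∞

/-- `f` is a finite, radial, nonincreasing density function of `μ` on `ℝ^d \ {0}`; the measure `μ`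
may in addition have an atom at the origin: `μ = a δ₀ + f(x) dx`.  The monotonicity clause
contains radiality (take `‖x‖ = ‖y‖`); the value `f 0` plays no role. -/
def IsUnimodalDensity {d : ℕ} (μ : Measure (EuclideanSpace ℝ (Fin d)))
    (f : EuclideanSpace ℝ (Fin d) → ℝ) : Prop :=
  (∀ x, x ≠ 0 → 0 ≤ f x) ∧
  (∀ x y, x ≠ 0 → y ≠ 0 → ‖x‖ ≤ ‖y‖ → f y ≤ f x) ∧
  ∃ a : ℝ≥0, μ = a • Measure.dirac 0 + volume.withDensity (fun x => ENNReal.ofReal (f x))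

/-- Isotropic unimodal measures on `ℝ^d`. -/
def IsUnimodal {d : ℕ} (μ : Measure (EuclideanSpace ℝ (Fin d))) : Prop :=
  ∃ f, IsUnimodalDensity μ f

/-- The Lévy-Khintchine exponent `ψ(ξ) = ∫ (1 - cos ⟨ξ, x⟩) ν(dx)`. -/
def levyExponent {d : ℕ} (ν : Measure (EuclideanSpace ℝ (Fin d)))
    (ξ : EuclideanSpace ℝ (Fin d)) : ℝ :=
  ∫ x, (1 - Real.cos (inner ℝ ξ x)) ∂ν

/-- `(P t, t ≥ 0)` are the one-dimensional distributions of a pure-jump isotropic unimodal Lévy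
process in `ℝ^d` with (isotropic unimodal) Lévy measure `ν`: each `P t` is an isotropic unimodal
probability measure, and the Lévy-Khintchine formula `∫ e^{i⟨ξ,x⟩} P t (dx) = e^{-tψ(ξ)}` holds
(so that `P` is a convolution semigroup with `P 0 = δ₀`). -/
structure IsUnimodalLevySemigroup {d : ℕ} (ν : Measure (EuclideanSpace ℝ (Fin d)))
    (P : ℝ → Measure (EuclideanSpace ℝ (Fin d))) : Prop where
  isLevyMeasure : IsLevyMeasure ν
  isUnimodal_levyMeasure : IsUnimodal ν
  isProbabilityMeasure : ∀ t, 0 ≤ t → IsProbabilityMeasure (P t)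
  isUnimodal : ∀ t, 0 ≤ t → IsUnimodal (P t)
  charFun_eq : ∀ t, 0 ≤ t → ∀ ξ,
    charFun (P t) ξ = Complex.exp (((-(t * levyExponent ν ξ) : ℝ)) : ℂ)

/-- The radial profile `u ↦ ψ(u)` of the (radial) exponent: `ψ(u) = ψ(ξ)` for `|ξ| = u`, read off
at `ξ = (u, 0, …, 0)`. -/
def psi {d : ℕ} [NeZero d] (ν : Measure (EuclideanSpace ℝ (Fin d))) (u : ℝ) : ℝ :=
  levyExponent ν (EuclideanSpace.single (0 : Fin d) u)

/-- The maximal function `φ*(u) = sup_{0 ≤ s ≤ u} φ(s)`, for `u ≥ 0`. -/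
def maximal (φ : ℝ → ℝ) (u : ℝ) : ℝ := sSup (φ '' Set.Icc 0 u)

/-- The generalized inverse `φ⁻(u) = inf {s ≥ 0 : φ(s) ≥ u}`, for `u ≥ 0`.  It is used below only
for unbounded `φ`, where the set is not empty. -/
def genInv (φ : ℝ → ℝ) (u : ℝ) : ℝ := sInf {s : ℝ | 0 ≤ s ∧ u ≤ φ s}

/-- `ψ*`. -/
def psiStar {d : ℕ} [NeZero d] (ν : Measure (EuclideanSpace ℝ (Fin d))) : ℝ → ℝ :=
  maximal (psi ν)

/-- `ψ⁻ = (ψ*)⁻`. -/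
def psiInv {d : ℕ} [NeZero d] (ν : Measure (EuclideanSpace ℝ (Fin d))) : ℝ → ℝ :=
  genInv (psiStar ν)

/-- The weak lower scaling condition WLSC(`α`, `θ₀`, `c`); it is global if `θ₀ = 0`. -/
def WLSC (φ : ℝ → ℝ) (α θ₀ c : ℝ) : Prop :=
  0 ≤ θ₀ ∧ 0 < c ∧ c ≤ 1 ∧ ∀ l θ : ℝ, 1 ≤ l → θ₀ < θ → c * l ^ α * φ θ ≤ φ (l * θ)

/-- The weak upper scaling condition WUSC(`α`, `θ₀`, `C`); it is global if `θ₀ = 0`. -/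
def WUSC (φ : ℝ → ℝ) (α θ₀ C : ℝ) : Prop :=
  0 ≤ θ₀ ∧ 1 ≤ C ∧ ∀ l θ : ℝ, 1 ≤ l → θ₀ < θ → φ (l * θ) ≤ C * l ^ α * φ θ

/-- The nonnegative numbers `a` and `b` are comparable with comparability constant `K`. -/
def Comparable (K a b : ℝ) : Prop :=
  0 ≤ a ∧ 0 ≤ b ∧ K⁻¹ * a ≤ b ∧ b ≤ K * a

end

end UnimodalLevy

/-! Everything reduces to one two-sided estimate for a unimodal measure with no mass at the origin,
density `g`, and `∫ (1 - cos⟨ξ,x⟩) dμ ≤ φ(|ξ|)`, where `φ` scales globally. Averaging over `ξ` on a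
segment bounds the tails of `μ` by `φ`, and monotonicity of `g` turns this into `g(x) ≲
φ(1/|x|)/|x|^d` (`IsUnimodalDensity.le_upperConst_mul`). If moreover the integral is at least `φ/2`
at `|ξ| = ε/|x|`, then a small ball (because `α₂ < 2`) and the far tail (because `α₁ > 0`) cannot
account for it. An annulus at distance about `1/|ξ|` must carry mass, and monotonicity gives the
matching lower bound (`exists_lower_bound`).

The estimate is used for `ν` with `φ = ψ`, and for `P t` with `φ = tψ`: there the integral is `1 -
exp(-tψ)`, comparable to `tψ` as long as `tψ ≤ 1`, that is for `|x|` at least of order `1/ψ⁻(1/t)`.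
For smaller `|x|`, monotonicity and `p_t(0) = ∫ exp(-tψ(2π|w|)) dw ≈ ψ⁻(1/t)^d` finish the argument.
The continuous density comes from Fourier inversion. -/

namespace UnimodalLevy

/-! ### Scaling functions, their maximal functions and generalized inverses. -/

/-- Global weak lower and upper scaling of a positive function on the half-line, vanishing at `0`. -/
structure GlobalScaling (φ : ℝ → ℝ) (α₁ c₁ α₂ c₂ : ℝ) : Prop where
  zero : φ 0 = 0
  pos : ∀ u, 0 < u → 0 < φ u
  lower_pos : 0 < c₁
  lower_le_one : c₁ ≤ 1
  one_le_upper : 1 ≤ c₂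
  exponent_pos : 0 < α₁
  exponent_lt : α₂ < 2
  lower : ∀ a b, 0 < a → a ≤ b → c₁ * (b / a) ^ α₁ * φ a ≤ φ b
  upper : ∀ a b, 0 < a → a ≤ b → φ b ≤ c₂ * (b / a) ^ α₂ * φ a

namespace GlobalScaling

variable {φ : ℝ → ℝ} {α₁ c₁ α₂ c₂ : ℝ}

theorem const_mul (h : GlobalScaling φ α₁ c₁ α₂ c₂) {t : ℝ} (ht : 0 < t) :
    GlobalScaling (fun u => t * φ u) α₁ c₁ α₂ c₂ where
  zero := by simp [h.zero]
  pos u hu := mul_pos ht (h.pos u hu)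
  lower_pos := h.lower_pos
  lower_le_one := h.lower_le_one
  one_le_upper := h.one_le_upper
  exponent_pos := h.exponent_pos
  exponent_lt := h.exponent_lt
  lower a b ha hab := by
    have := mul_le_mul_of_nonneg_left (h.lower a b ha hab) ht.le
    linarith
  upper a b ha hab := by
    have := mul_le_mul_of_nonneg_left (h.upper a b ha hab) ht.le
    linarith

/-- Since `α₁ > 0`, the power in the lower scaling is at least `1`. This replaces monotonicity of
`φ` throughout, at the price of a factor `c₁⁻¹`, and makes `φ*` comparable to `φ`. -/
theorem almost_mono (h : GlobalScaling φ α₁ c₁ α₂ c₂) {a b : ℝ} (ha : 0 ≤ a) (hab : a ≤ b) :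
    φ a ≤ c₁⁻¹ * φ b := by
  have hc := h.lower_pos
  rcases ha.eq_or_lt with rfl | ha
  · rw [h.zero]
    rcases hab.eq_or_lt with rfl | hb
    · simp [h.zero]
    · have := h.pos b hb
      positivity
  · rw [le_inv_mul_iff₀ hc]
    refine le_trans ?_ (h.lower a b ha hab)
    have h1 : 1 ≤ (b / a) ^ α₁ :=
      Real.one_le_rpow ((one_le_div ha).2 hab) h.exponent_pos.le
    have := h.pos a ha
    exact mul_le_mul_of_nonneg_right (le_mul_of_one_le_right hc.le h1) this.le

theorem nonneg (h : GlobalScaling φ α₁ c₁ α₂ c₂) {u : ℝ} (hu : 0 ≤ u) : 0 ≤ φ u := by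
  rcases hu.eq_or_lt with rfl | hu
  · exact h.zero.ge
  · exact (h.pos u hu).le

theorem upper_mul (h : GlobalScaling φ α₁ c₁ α₂ c₂) {l u : ℝ} (hl : 1 ≤ l) (hu : 0 < u) :
    φ (l * u) ≤ c₂ * l ^ α₂ * φ u := by
  have := h.upper u (l * u) hu (le_mul_of_one_le_left hu.le hl)
  rwa [mul_div_cancel_right₀ _ hu.ne'] at this

theorem lower_mul (h : GlobalScaling φ α₁ c₁ α₂ c₂) {l u : ℝ} (hl : 1 ≤ l) (hu : 0 < u) :
    c₁ * l ^ α₁ * φ u ≤ φ (l * u) := by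
  have := h.lower u (l * u) hu (le_mul_of_one_le_left hu.le hl)
  rwa [mul_div_cancel_right₀ _ hu.ne'] at this

theorem bddAbove (h : GlobalScaling φ α₁ c₁ α₂ c₂) (u : ℝ) :
    BddAbove (φ '' Set.Icc 0 u) :=
  ⟨c₁⁻¹ * φ u, by rintro _ ⟨s, hs, rfl⟩; exact h.almost_mono hs.1 hs.2⟩

theorem le_maximal (h : GlobalScaling φ α₁ c₁ α₂ c₂) {s u : ℝ} (hs : 0 ≤ s) (hu : s ≤ u) :
    φ s ≤ maximal φ u :=
  le_csSup (h.bddAbove u) ⟨s, ⟨hs, hu⟩, rfl⟩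

theorem maximal_le (h : GlobalScaling φ α₁ c₁ α₂ c₂) {u : ℝ} (hu : 0 ≤ u) :
    maximal φ u ≤ c₁⁻¹ * φ u :=
  csSup_le ⟨φ u, u, ⟨hu, le_rfl⟩, rfl⟩ (by
    rintro _ ⟨s, hs, rfl⟩; exact h.almost_mono hs.1 hs.2)

theorem maximal_mono (h : GlobalScaling φ α₁ c₁ α₂ c₂) {s u : ℝ} (hs : 0 ≤ s) (hu : s ≤ u) :
    maximal φ s ≤ maximal φ u :=
  csSup_le ⟨φ s, s, ⟨hs, le_rfl⟩, rfl⟩ (by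
    rintro _ ⟨v, hv, rfl⟩; exact h.le_maximal hv.1 (hv.2.trans hu))

theorem exists_ge (h : GlobalScaling φ α₁ c₁ α₂ c₂) (v : ℝ) : ∃ s, 0 < s ∧ v ≤ φ s := by
  have h1 := h.pos 1 one_pos
  have hc := h.lower_pos
  have := ((tendsto_rpow_atTop h.exponent_pos).const_mul_atTop (mul_pos hc h1)).eventually_ge_atTop v
  obtain ⟨l, hl, hl1⟩ := (this.and (Filter.eventually_ge_atTop 1)).exists
  refine ⟨l, by linarith, hl.trans ?_⟩
  have := h.lower_mul hl1 one_pos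
  rw [mul_one] at this
  linarith

theorem exists_lt (h : GlobalScaling φ α₁ c₁ α₂ c₂) {v : ℝ} (hv : 0 < v) :
    ∃ s, 0 < s ∧ φ s < v := by
  have h1 := h.pos 1 one_pos
  have hc := h.lower_pos
  have := ((tendsto_rpow_atTop h.exponent_pos).const_mul_atTop
    (mul_pos hc hv)).eventually_gt_atTop (φ 1)
  obtain ⟨l, hl, hl1⟩ := (this.and (Filter.eventually_ge_atTop 1)).exists
  have hl0 : 0 < l := by linarith
  refine ⟨l⁻¹, by positivity, ?_⟩
  have := h.lower_mul (u := l⁻¹) hl1 (by positivity)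
  rw [mul_inv_cancel₀ hl0.ne'] at this
  have hp : 0 < c₁ * l ^ α₁ := by positivity
  refine lt_of_mul_lt_mul_left (this.trans_lt (hl.trans_eq ?_)) hp.le
  ring

theorem genInv_pos (h : GlobalScaling φ α₁ c₁ α₂ c₂) {v : ℝ} (hv : 0 < v) :
    0 < genInv (maximal φ) v := by
  obtain ⟨s, hs, hsv⟩ := h.exists_lt (v := c₁ * v) (mul_pos h.lower_pos hv)
  have hmax : maximal φ s < v := by
    refine (h.maximal_le hs.le).trans_lt ?_
    rwa [inv_mul_lt_iff₀ h.lower_pos]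
  obtain ⟨w, hw, hwv⟩ := h.exists_ge v
  refine hs.trans_le (le_csInf ⟨w, hw.le, hwv.trans (h.le_maximal hw.le le_rfl)⟩ ?_)
  rintro r ⟨hr, hrv⟩
  by_contra! hlt
  exact absurd (h.maximal_mono hr hlt.le) (by linarith)

/-- No continuity of `φ` is available at the infimum `u`, so the value is compared with that at `u /
2`, where `φ* < v`; upper scaling pays for the doubling. The companion bound `le_apply_genInv` uses
instead a point below `2u` where `φ* ≥ v`. -/
theorem apply_genInv_le (h : GlobalScaling φ α₁ c₁ α₂ c₂) {v : ℝ} (hv : 0 < v) :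
    φ (genInv (maximal φ) v) ≤ c₂ * 2 ^ α₂ * v := by
  have h0 := h.genInv_pos hv
  set u := genInv (maximal φ) v with hu
  have h2 : maximal φ (u / 2) < v := by
    by_contra! hle
    have : u ≤ u / 2 := csInf_le ⟨0, fun r hr => hr.1⟩ ⟨by positivity, hle⟩
    linarith
  have h3 := h.upper_mul (l := 2) (u := u / 2) (by norm_num) (by positivity)
  rw [mul_div_cancel₀ u two_ne_zero] at h3
  have hc := h.one_le_upper
  refine h3.trans (mul_le_mul_of_nonneg_left ?_ (by positivity))
  exact (h.le_maximal (by positivity) le_rfl).trans h2.le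

theorem le_apply_genInv (h : GlobalScaling φ α₁ c₁ α₂ c₂) {v : ℝ} (hv : 0 < v) :
    c₁ * v ≤ c₂ * 2 ^ α₂ * φ (genInv (maximal φ) v) := by
  have h0 := h.genInv_pos hv
  obtain ⟨w, hw, hwv⟩ := h.exists_ge v
  have hne : {s : ℝ | 0 ≤ s ∧ v ≤ maximal φ s}.Nonempty :=
    ⟨w, hw.le, hwv.trans (h.le_maximal hw.le le_rfl)⟩
  set u := genInv (maximal φ) v with hu
  obtain ⟨s, ⟨hs0, hsv⟩, hs⟩ := exists_lt_of_csInf_lt hne (show genInv (maximal φ) v < 2 * u by linarith)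
  have h3 := h.upper_mul (l := 2) (u := u) (by norm_num) h0
  refine le_trans ?_ h3
  have h4 := (hsv.trans (h.maximal_mono hs0 hs.le)).trans (h.maximal_le (by positivity))
  rwa [le_inv_mul_iff₀ h.lower_pos] at h4

end GlobalScaling

/-- One nonzero value forces positivity everywhere: a zero of `φ` would spread to the right by upper
scaling and to the left by lower scaling. -/
theorem WLSC.globalScaling {φ : ℝ → ℝ} {α₁ c₁ α₂ c₂ : ℝ} (hl : WLSC φ α₁ 0 c₁)
    (hu : WUSC φ α₂ 0 c₂) (h0 : φ 0 = 0) (hnn : ∀ u, 0 ≤ φ u) (hne : ∃ u, 0 < u ∧ φ u ≠ 0)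
    (hα₁ : 0 < α₁) (hα₂ : α₂ < 2) : GlobalScaling φ α₁ c₁ α₂ c₂ := by
  obtain ⟨-, hc, hc1, hl⟩ := hl
  obtain ⟨-, hC, hu⟩ := hu
  obtain ⟨w, hw, hwne⟩ := hne
  have hL : ∀ a b, 0 < a → a ≤ b → c₁ * (b / a) ^ α₁ * φ a ≤ φ b := by
    intro a b ha hab
    have := hl (b / a) a ((one_le_div ha).2 hab) ha
    rwa [div_mul_cancel₀ _ ha.ne'] at this
  have hU : ∀ a b, 0 < a → a ≤ b → φ b ≤ c₂ * (b / a) ^ α₂ * φ a := by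
    intro a b ha hab
    have := hu (b / a) a ((one_le_div ha).2 hab) ha
    rwa [div_mul_cancel₀ _ ha.ne'] at this
  refine ⟨h0, fun u hu0 => (hnn u).lt_of_ne' fun hz => hwne ?_, hc, hc1, hC, hα₁, hα₂, hL, hU⟩
  rcases le_total u w with huw | huw
  · have := hU u w hu0 huw
    rw [hz, mul_zero] at this
    exact le_antisymm this (hnn w)
  · have := hL w u hw huw
    rw [hz] at this
    have hp : 0 < c₁ * (u / w) ^ α₁ := by positivity
    exact le_antisymm (by nlinarith [hnn w]) (hnn w)

end UnimodalLevy

/-! ### Tail bounds by averaging the exponent, and radial profiles of unimodal densities. -/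

namespace UnimodalLevy

section Average

/-- The integral equals `2R - 2 sin(Ry)/y`, and the hypothesis says `2/|y| ≤ R`. -/
theorem integral_one_sub_cos_ge {R y : ℝ} (h : 2 ≤ R * |y|) :
    R ≤ ∫ s in (-R)..R, (1 - Real.cos (s * y)) := by
  have hy : y ≠ 0 := by
    rintro rfl
    simp at h
    linarith
  have hy' : 0 < |y| := abs_pos.2 hy
  rw [intervalIntegral.integral_sub (by simp) (by apply Continuous.intervalIntegrable; fun_prop),
    intervalIntegral.integral_comp_mul_right _ hy]
  simp only [integral_cos, intervalIntegral.integral_const, smul_eq_mul, neg_mul, Real.sin_neg]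
  have h1 : y⁻¹ * (Real.sin (R * y) - -Real.sin (R * y)) ≤ |y|⁻¹ * 2 := by
    refine (le_abs_self _).trans ?_
    rw [abs_mul, abs_inv]
    refine mul_le_mul_of_nonneg_left ?_ (by positivity)
    rw [sub_neg_eq_add, ← two_mul, abs_mul, abs_two]
    nlinarith [Real.abs_sin_le_one (R * y)]
  have h2 : |y|⁻¹ * 2 ≤ R := by
    rw [inv_mul_le_iff₀ hy']
    linarith
  linarith

theorem lintegral_one_sub_cos_ge {R y : ℝ} (hR : 0 < R) (h : 2 ≤ R * |y|) :
    ENNReal.ofReal R ≤ ∫⁻ s in Set.Ioc (-R) R, ENNReal.ofReal (1 - Real.cos (s * y)) := by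
  have hint : IntervalIntegrable (fun s => 1 - Real.cos (s * y)) volume (-R) R := by
    apply Continuous.intervalIntegrable; fun_prop
  rw [← ofReal_integral_eq_lintegral_ofReal hint.1
    (Filter.Eventually.of_forall fun s => by simp [Real.cos_le_one])]
  refine ENNReal.ofReal_le_ofReal ?_
  rw [← intervalIntegral.integral_of_le (by linarith)]
  exact integral_one_sub_cos_ge h

variable {E : Type*} [NormedAddCommGroup E] [InnerProductSpace ℝ E] [MeasurableSpace E]
  [BorelSpace E] [SecondCountableTopology E]

/-- The bound is averaged over `ξ = s • e`, `|s| ≤ R`, and the integrals are swapped by Tonelli. The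
factor `2` is the length `2R` of the segment against the gain `R`. -/
theorem measure_inner_ge_le (μ : Measure E) [SFinite μ] {R : ℝ} (hR : 0 < R) {B : ℝ≥0∞}
    (hB : ∀ ξ : E, ‖ξ‖ ≤ R → ∫⁻ x, ENNReal.ofReal (1 - Real.cos (inner ℝ ξ x)) ∂μ ≤ B)
    {e : E} (he : ‖e‖ ≤ 1) :
    μ {x | 2 ≤ R * |inner ℝ e x|} ≤ 2 * B := by
  have hmeas : MeasurableSet {x : E | 2 ≤ R * |inner ℝ e x|} :=
    measurableSet_le measurable_const (by fun_prop)
  have key : ENNReal.ofReal R * μ {x | 2 ≤ R * |inner ℝ e x|} ≤ ENNReal.ofReal R * (2 * B) := by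
    calc ENNReal.ofReal R * μ {x | 2 ≤ R * |inner ℝ e x|}
        = ∫⁻ _ in {x | 2 ≤ R * |inner ℝ e x|}, ENNReal.ofReal R ∂μ := by simp
      _ ≤ ∫⁻ x in {x | 2 ≤ R * |inner ℝ e x|}, (∫⁻ s in Set.Ioc (-R) R,
            ENNReal.ofReal (1 - Real.cos (s * inner ℝ e x))) ∂μ :=
          setLIntegral_mono' hmeas fun x hx => lintegral_one_sub_cos_ge hR hx
      _ ≤ ∫⁻ x, (∫⁻ s in Set.Ioc (-R) R,
            ENNReal.ofReal (1 - Real.cos (s * inner ℝ e x))) ∂μ := setLIntegral_le_lintegral _ _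
      _ = ∫⁻ s in Set.Ioc (-R) R, ∫⁻ x, ENNReal.ofReal (1 - Real.cos (s * inner ℝ e x)) ∂μ := by
          rw [lintegral_lintegral_swap]
          have : Measurable fun p : E × ℝ =>
            ENNReal.ofReal (1 - Real.cos (p.2 * inner ℝ e p.1)) := by fun_prop
          exact this.aemeasurable
      _ ≤ ∫⁻ s in Set.Ioc (-R) R, B := by
          refine setLIntegral_mono' measurableSet_Ioc fun s hs => ?_
          have := hB (s • e) (by
            rw [norm_smul, Real.norm_eq_abs]
            exact (mul_le_of_le_one_right (abs_nonneg _) he).trans (abs_le.2 ⟨hs.1.le, hs.2⟩))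
          simpa only [real_inner_smul_left] using this
      _ = ENNReal.ofReal R * (2 * B) := by
          rw [setLIntegral_const, Real.volume_Ioc, sub_neg_eq_add, ← two_mul,
            ENNReal.ofReal_mul (by norm_num), ENNReal.ofReal_ofNat]
          ring
  exact (ENNReal.mul_le_mul_iff_right (by simpa using hR) ENNReal.ofReal_ne_top).1 key

end Average

variable {d : ℕ}

theorem norm_le_sum_abs (x : EuclideanSpace ℝ (Fin d)) : ‖x‖ ≤ ∑ i, |x i| := by
  rw [EuclideanSpace.norm_eq]
  refine Real.sqrt_le_iff.2 ⟨Finset.sum_nonneg fun i _ => abs_nonneg _, ?_⟩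
  simpa using Finset.sum_sq_le_sq_sum_of_nonneg (s := Finset.univ) (f := fun i => |x i|)
    fun i _ => abs_nonneg _

/-- If `‖x‖ ≥ ρ`, some coordinate is at least `ρ / d` in absolute value; this fixes the frequency
`2d/ρ`, and the union over coordinates costs a factor `d`. -/
theorem measure_norm_ge_le [NeZero d] (μ : Measure (EuclideanSpace ℝ (Fin d))) [SFinite μ] {ρ : ℝ}
    (hρ : 0 < ρ) {B : ℝ≥0∞}
    (hB : ∀ ξ, ‖ξ‖ ≤ 2 * d / ρ → ∫⁻ x, ENNReal.ofReal (1 - Real.cos (inner ℝ ξ x)) ∂μ ≤ B) :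
    μ {x | ρ ≤ ‖x‖} ≤ 2 * d * B := by
  have hd : (0 : ℝ) < d := by exact_mod_cast Nat.pos_of_ne_zero (NeZero.ne d)
  have hsub : {x : EuclideanSpace ℝ (Fin d) | ρ ≤ ‖x‖} ⊆
      ⋃ i, {x | 2 ≤ 2 * d / ρ * |inner ℝ (EuclideanSpace.single i (1 : ℝ)) x|} := by
    intro x hx
    simp only [Set.mem_iUnion, Set.mem_ofPred_eq, EuclideanSpace.inner_single_left, map_one, one_mul]
      at hx ⊢
    by_contra! hlt
    have hlt' : ∀ i, |x i| < ρ / d := fun i => by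
      have := hlt i
      rw [div_mul_eq_mul_div, div_lt_iff₀ hρ] at this
      rw [lt_div_iff₀ hd]
      linarith
    have := Finset.sum_lt_sum_of_nonempty (s := Finset.univ) ⟨0, Finset.mem_univ _⟩
      fun i _ => hlt' i
    rw [Finset.sum_const, Finset.card_univ, Fintype.card_fin, nsmul_eq_mul,
      mul_div_cancel₀ _ hd.ne'] at this
    linarith [norm_le_sum_abs x]
  calc μ {x | ρ ≤ ‖x‖} ≤ _ := measure_mono hsub
    _ ≤ ∑ i, μ {x | 2 ≤ 2 * d / ρ * |inner ℝ (EuclideanSpace.single i (1 : ℝ)) x|} :=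
        measure_iUnion_fintype_le _ _
    _ ≤ ∑ _i : Fin d, 2 * B := Finset.sum_le_sum fun i _ =>
        measure_inner_ge_le μ (by positivity) hB (by simp)
    _ = 2 * d * B := by simp; ring

/-- The volume of the unit ball. -/
noncomputable def unitBallVolume (d : ℕ) : ℝ :=
  (volume : Measure (EuclideanSpace ℝ (Fin d))).real (Metric.ball 0 1)

theorem unitBallVolume_pos (d : ℕ) : 0 < unitBallVolume d :=
  ENNReal.toReal_pos (Metric.measure_ball_pos volume _ one_pos).ne' measure_ball_lt_top.ne

theorem volume_ball_eq (x : EuclideanSpace ℝ (Fin d)) {r : ℝ} (hr : 0 < r) :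
    volume (Metric.ball x r) = ENNReal.ofReal (r ^ d * unitBallVolume d) := by
  rw [Measure.addHaar_ball_of_pos volume x hr, finrank_euclideanSpace_fin,
    ENNReal.ofReal_mul (by positivity), unitBallVolume, Measure.real,
    ENNReal.ofReal_toReal measure_ball_lt_top.ne]

/-- The profile of a radial function, extended by `∞` to the nonpositive half-line. -/
noncomputable def radialProfile [NeZero d] (g : EuclideanSpace ℝ (Fin d) → ℝ) (r : ℝ) : ℝ≥0∞ :=
  if r ≤ 0 then ⊤ else ENNReal.ofReal (g (EuclideanSpace.single 0 r))

namespace IsUnimodalDensity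

variable {μ : Measure (EuclideanSpace ℝ (Fin d))} {g : EuclideanSpace ℝ (Fin d) → ℝ}

theorem eq_withDensity (h : IsUnimodalDensity μ g) (h0 : μ {0} = 0) :
    μ = volume.withDensity fun x => ENNReal.ofReal (g x) := by
  obtain ⟨a, ha⟩ := h.2.2
  have : (a : ℝ≥0∞) = 0 := by
    rw [ha] at h0
    simp only [Measure.coe_add, Pi.add_apply, add_eq_zero, Measure.coe_nnreal_smul_apply] at h0
    simpa using h0.1
  have ha0 : a = 0 := by exact_mod_cast this
  rw [ha, ha0]
  simp

/-- Being antitone on all of `ℝ` yields measurability of the density, which is not assumed, and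
countability of the discontinuities. -/
theorem antitone_radialProfile [NeZero d] (h : IsUnimodalDensity μ g) :
    Antitone (radialProfile g) := by
  intro r s hrs
  unfold radialProfile
  split_ifs with h1 h2 h2
  · exact le_rfl
  · exact absurd (hrs.trans h1) h2
  · exact le_top
  · have hr : 0 < r := not_le.1 h2
    have hs : 0 < s := not_le.1 h1
    refine ENNReal.ofReal_le_ofReal (h.2.1 _ _ ?_ ?_ ?_)
    · simpa using hr.ne'
    · simpa using hs.ne'
    · simpa [abs_of_pos hr, abs_of_pos hs] using hrs

theorem ofReal_eq_radialProfile [NeZero d] (h : IsUnimodalDensity μ g)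
    {x : EuclideanSpace ℝ (Fin d)} (hx : x ≠ 0) :
    ENNReal.ofReal (g x) = radialProfile g ‖x‖ := by
  have hx' : 0 < ‖x‖ := norm_pos_iff.2 hx
  have hs : (EuclideanSpace.single (0 : Fin d) ‖x‖) ≠ 0 := by simpa using hx
  rw [radialProfile, if_neg (not_le.2 hx')]
  congr 1
  exact le_antisymm (h.2.1 _ _ hs hx (by simp)) (h.2.1 _ _ hx hs (by simp))

theorem ae_eq_radialProfile [NeZero d] (h : IsUnimodalDensity μ g) :
    (fun x => ENNReal.ofReal (g x)) =ᵐ[volume] fun x => radialProfile g ‖x‖ := by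
  filter_upwards [Measure.ae_ne volume (0 : EuclideanSpace ℝ (Fin d))] with x hx
  exact h.ofReal_eq_radialProfile hx

theorem aemeasurable_ofReal [NeZero d] (h : IsUnimodalDensity μ g) :
    AEMeasurable (fun x => ENNReal.ofReal (g x)) volume :=
  AEMeasurable.congr (h.antitone_radialProfile.measurable.comp measurable_norm).aemeasurable
    h.ae_eq_radialProfile.symm

theorem measurableSet_apply (h : IsUnimodalDensity μ g) (h0 : μ {0} = 0)
    {s : Set (EuclideanSpace ℝ (Fin d))} (hs : MeasurableSet s) :
    μ s = ∫⁻ x in s, ENNReal.ofReal (g x) := by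
  conv_lhs => rw [h.eq_withDensity h0]
  exact withDensity_apply _ hs

theorem sFinite (h : IsUnimodalDensity μ g) (h0 : μ {0} = 0) : SFinite μ := by
  rw [h.eq_withDensity h0]
  infer_instance

theorem lintegral_eq [NeZero d] (h : IsUnimodalDensity μ g) (h0 : μ {0} = 0)
    {F : EuclideanSpace ℝ (Fin d) → ℝ≥0∞} (hF : Measurable F) :
    ∫⁻ x, F x ∂μ = ∫⁻ x, ENNReal.ofReal (g x) * F x := by
  conv_lhs => rw [h.eq_withDensity h0]
  exact lintegral_withDensity_eq_lintegral_mul₀ h.aemeasurable_ofReal hF.aemeasurable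

end IsUnimodalDensity
end UnimodalLevy

/-! ### Pointwise upper bound for unimodal densities. -/

namespace UnimodalLevy

variable {d : ℕ}

theorem lintegral_ball_norm_rpow [NeZero d] {b ρ : ℝ} (hb : 0 < b) (hρ : 0 < ρ) :
    ∫⁻ x in Metric.ball (0 : EuclideanSpace ℝ (Fin d)) ρ, ENNReal.ofReal (‖x‖ ^ (b - d)) =
      ENNReal.ofReal (d * unitBallVolume d * (ρ ^ b / b)) := by
  have hd : 1 ≤ d := Nat.pos_of_ne_zero (NeZero.ne d)
  have hpow : ∀ y ∈ Set.Ioo 0 ρ, y ^ (d - 1) • y ^ (b - d) = y ^ (b - 1) := by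
    intro y hy
    rw [smul_eq_mul, ← Real.rpow_natCast, ← Real.rpow_add hy.1, Nat.cast_sub hd]
    congr 1
    push_cast
    ring
  have hint : IntegrableOn (fun x : EuclideanSpace ℝ (Fin d) => ‖x‖ ^ (b - d))
      (Metric.ball 0 ρ) volume := by
    rw [integrableOn_fun_norm_addHaar volume (f := fun r : ℝ => r ^ (b - d)),
      finrank_euclideanSpace_fin, integrableOn_congr_fun hpow measurableSet_Ioo]
    have := (intervalIntegral.intervalIntegrable_rpow' (r := b - 1) (a := 0) (b := ρ)
      (by linarith)).1
    exact this.mono_set Set.Ioo_subset_Ioc_self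
  rw [← ofReal_integral_eq_lintegral_ofReal hint
    (Filter.Eventually.of_forall fun x => by positivity)]
  congr 1
  have h1 : ∀ x : EuclideanSpace ℝ (Fin d),
      (Metric.ball (0 : EuclideanSpace ℝ (Fin d)) ρ).indicator (fun x => ‖x‖ ^ (b - d)) x =
      (Set.Iio ρ).indicator (fun r : ℝ => r ^ (b - d)) ‖x‖ := by
    intro x
    simp [Set.indicator]
  rw [← integral_indicator measurableSet_ball]
  simp_rw [h1]
  rw [integral_fun_norm_addHaar volume, finrank_euclideanSpace_fin]
  have h2 : ∀ y : ℝ, y ^ (d - 1) • (Set.Iio ρ).indicator (fun r : ℝ => r ^ (b - d)) y =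
      (Set.Iio ρ).indicator (fun r : ℝ => r ^ (d - 1) • r ^ (b - d)) y := by
    intro y
    by_cases hy : y ∈ Set.Iio ρ <;> simp [hy]
  simp_rw [h2]
  rw [setIntegral_indicator measurableSet_Iio, Set.Ioi_inter_Iio,
    setIntegral_congr_fun measurableSet_Ioo hpow, ← integral_Ioc_eq_integral_Ioo,
    ← intervalIntegral.integral_of_le hρ.le, integral_rpow (Or.inl (by linarith))]
  rw [unitBallVolume, nsmul_eq_mul, smul_eq_mul]
  simp [Real.zero_rpow hb.ne', mul_assoc]

theorem exists_one_le_le_rpow {b : ℝ} (hb : 0 < b) (M a : ℝ) : ∃ l : ℝ, 1 ≤ l ∧ a ≤ l ∧ M ≤ l ^ b := by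
  obtain ⟨l, h1, h2, h3⟩ := ((Filter.eventually_ge_atTop 1).and ((Filter.eventually_ge_atTop a).and
    ((tendsto_rpow_atTop hb).eventually_ge_atTop M))).exists
  exact ⟨l, h1, h2, h3⟩

/-- The constant of the upper bound of unimodal densities. -/
noncomputable def upperConst (d : ℕ) (c₁ α₂ c₂ : ℝ) : ℝ :=
  2 * d * c₁⁻¹ * (c₂ * (4 * d) ^ α₂) * 4 ^ d / unitBallVolume d

theorem upperConst_pos (d : ℕ) [NeZero d] {c₁ α₂ c₂ : ℝ} (hc₁ : 0 < c₁) (hc₂ : 1 ≤ c₂) :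
    0 < upperConst d c₁ α₂ c₂ := by
  have hd : (0 : ℝ) < d := by exact_mod_cast Nat.pos_of_ne_zero (NeZero.ne d)
  have := unitBallVolume_pos d
  unfold upperConst
  positivity

variable [NeZero d] {μ : Measure (EuclideanSpace ℝ (Fin d))} {g : EuclideanSpace ℝ (Fin d) → ℝ}
  {φ : ℝ → ℝ} {α₁ c₁ α₂ c₂ : ℝ}

theorem measure_norm_ge_le_of_scaling [SFinite μ] (hφ : GlobalScaling φ α₁ c₁ α₂ c₂)
    (hup : ∀ ξ, ∫⁻ x, ENNReal.ofReal (1 - Real.cos (inner ℝ ξ x)) ∂μ ≤ ENNReal.ofReal (φ ‖ξ‖))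
    {ρ : ℝ} (hρ : 0 < ρ) :
    μ {x | ρ ≤ ‖x‖} ≤ ENNReal.ofReal (2 * d * (c₁⁻¹ * φ (2 * d / ρ))) := by
  refine (measure_norm_ge_le μ hρ (B := ENNReal.ofReal (c₁⁻¹ * φ (2 * d / ρ)))
    fun ξ hξ => (hup ξ).trans (ENNReal.ofReal_le_ofReal
      (hφ.almost_mono (norm_nonneg _) hξ))).trans_eq ?_
  rw [ENNReal.ofReal_mul (p := 2 * (d : ℝ)) (by positivity), ENNReal.ofReal_mul zero_le_two,
    ENNReal.ofReal_ofNat, ENNReal.ofReal_natCast]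

namespace IsUnimodalDensity

theorem le_upperConst_mul (h : IsUnimodalDensity μ g) (h0 : μ {0} = 0)
    (hφ : GlobalScaling φ α₁ c₁ α₂ c₂)
    (hup : ∀ ξ, ∫⁻ x, ENNReal.ofReal (1 - Real.cos (inner ℝ ξ x)) ∂μ ≤ ENNReal.ofReal (φ ‖ξ‖))
    {x : EuclideanSpace ℝ (Fin d)} (hx : x ≠ 0) :
    g x ≤ upperConst d c₁ α₂ c₂ * (φ (1 / ‖x‖) / ‖x‖ ^ d) := by
  have := h.sFinite h0
  have hd : (1 : ℝ) ≤ d := by exact_mod_cast Nat.pos_of_ne_zero (NeZero.ne d)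
  have hr : 0 < ‖x‖ := norm_pos_iff.2 hx
  have hV := unitBallVolume_pos d
  have hc₁ := hφ.lower_pos
  set r := ‖x‖ with hrdef
  -- This ball lies in the annulus `r/2 ≤ ‖y‖ ≤ r`, where `g ≥ g x` by monotonicity, so its explicit
  -- volume times `g x` is at most the tail mass beyond `r/2`.
  have hball : ∀ y ∈ Metric.ball ((3 / 4 : ℝ) • x) (r / 4), r / 2 ≤ ‖y‖ ∧ ‖y‖ ≤ r := by
    intro y hy
    rw [mem_ball_iff_norm] at hy
    have h1 : ‖(3 / 4 : ℝ) • x‖ = 3 / 4 * r := by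
      rw [norm_smul, ← hrdef]; norm_num
    have h2 := abs_le.1 (abs_norm_sub_norm_le y ((3 / 4 : ℝ) • x))
    rw [h1] at h2
    constructor <;> linarith
  have hbound : ENNReal.ofReal (g x * ((r / 4) ^ d * unitBallVolume d)) ≤
      ENNReal.ofReal (2 * d * (c₁⁻¹ * φ (2 * d / (r / 2)))) := by
    calc ENNReal.ofReal (g x * ((r / 4) ^ d * unitBallVolume d))
        = ∫⁻ _ in Metric.ball ((3 / 4 : ℝ) • x) (r / 4), ENNReal.ofReal (g x) := by
          rw [setLIntegral_const, volume_ball_eq _ (by positivity),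
            ENNReal.ofReal_mul (h.1 x hx)]
      _ ≤ ∫⁻ y in Metric.ball ((3 / 4 : ℝ) • x) (r / 4), ENNReal.ofReal (g y) := by
          refine setLIntegral_mono' measurableSet_ball fun y hy => ?_
          obtain ⟨h1, h2⟩ := hball y hy
          exact ENNReal.ofReal_le_ofReal
            (h.2.1 y x (norm_pos_iff.1 (by linarith)) hx h2)
      _ = μ (Metric.ball ((3 / 4 : ℝ) • x) (r / 4)) :=
          (h.measurableSet_apply h0 measurableSet_ball).symm
      _ ≤ μ {y | r / 2 ≤ ‖y‖} := measure_mono fun y hy => (hball y hy).1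
      _ ≤ _ := measure_norm_ge_le_of_scaling hφ hup (by positivity)
  have hφ0 : 0 ≤ φ (2 * d / (r / 2)) := hφ.nonneg (by positivity)
  rw [ENNReal.ofReal_le_ofReal_iff (by positivity)] at hbound
  have h3 : φ (2 * d / (r / 2)) ≤ c₂ * (4 * d) ^ α₂ * φ (1 / r) := by
    have := hφ.upper_mul (l := 4 * d) (u := 1 / r) (by linarith) (by positivity)
    convert this using 2
    field_simp
    norm_num
  have h4 : g x * ((r / 4) ^ d * unitBallVolume d) ≤
      2 * d * (c₁⁻¹ * (c₂ * (4 * d) ^ α₂ * φ (1 / r))) :=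
    hbound.trans (by gcongr)
  rw [← le_div_iff₀ (by positivity)] at h4
  refine h4.trans_eq ?_
  rw [upperConst, div_pow]
  field_simp

end IsUnimodalDensity
end UnimodalLevy

/-! ### Pointwise lower bound for unimodal densities. -/

namespace UnimodalLevy

variable {d : ℕ} [NeZero d] {μ : Measure (EuclideanSpace ℝ (Fin d))}
  {g : EuclideanSpace ℝ (Fin d) → ℝ} {φ : ℝ → ℝ} {α₁ c₁ α₂ c₂ : ℝ}

namespace IsUnimodalDensity

theorem setLIntegral_eq (h : IsUnimodalDensity μ g) (h0 : μ {0} = 0)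
    {F : EuclideanSpace ℝ (Fin d) → ℝ≥0∞} (hF : Measurable F) {s : Set (EuclideanSpace ℝ (Fin d))}
    (hs : MeasurableSet s) :
    ∫⁻ x in s, F x ∂μ = ∫⁻ x in s, ENNReal.ofReal (g x) * F x := by
  rw [← lintegral_indicator hs, h.lintegral_eq h0 (hF.indicator hs), ← lintegral_indicator hs]
  congr 1 with x
  by_cases hx : x ∈ s <;> simp [hx]

/-- With `1 - cos ≤ |ξ|²|x|²`, the upper bound on `g` and upper scaling, the integrand is `≲ φ(|ξ|)
|ξ|^(2-α₂) |x|^(2-α₂-d)`, integrable at `0`. The factor `ε^(2-α₂)` makes this part negligible. -/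
theorem setLIntegral_ball_le (h : IsUnimodalDensity μ g) (h0 : μ {0} = 0)
    (hφ : GlobalScaling φ α₁ c₁ α₂ c₂)
    (hup : ∀ ξ, ∫⁻ x, ENNReal.ofReal (1 - Real.cos (inner ℝ ξ x)) ∂μ ≤ ENNReal.ofReal (φ ‖ξ‖))
    {ξ : EuclideanSpace ℝ (Fin d)} (hξ : ξ ≠ 0) {ε : ℝ} (hε : 0 < ε) (hε1 : ε ≤ 1) :
    ∫⁻ x in Metric.ball 0 (ε / ‖ξ‖), ENNReal.ofReal (1 - Real.cos (inner ℝ ξ x)) ∂μ ≤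
      ENNReal.ofReal (upperConst d c₁ α₂ c₂ * c₂ * (d * unitBallVolume d / (2 - α₂)) *
        ε ^ (2 - α₂) * φ ‖ξ‖) := by
  have hu : 0 < ‖ξ‖ := norm_pos_iff.2 hξ
  have hK := upperConst_pos d (α₂ := α₂) hφ.lower_pos hφ.one_le_upper
  have hb : 0 < 2 - α₂ := by linarith [hφ.exponent_lt]
  have hc₂ : 0 < c₂ := by linarith [hφ.one_le_upper]
  have hφu := hφ.pos _ hu
  have hpt : ∀ x ∈ Metric.ball (0 : EuclideanSpace ℝ (Fin d)) (ε / ‖ξ‖),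
      ENNReal.ofReal (g x) * ENNReal.ofReal (1 - Real.cos (inner ℝ ξ x)) ≤
      ENNReal.ofReal (upperConst d c₁ α₂ c₂ * c₂ * φ ‖ξ‖ * ‖ξ‖ ^ (2 - α₂)) *
        ENNReal.ofReal (‖x‖ ^ ((2 - α₂) - d)) := by
    intro x hx
    rcases eq_or_ne x 0 with rfl | hx0
    -- The arbitrary value `g 0` is harmless because `1 - cos 0 = 0`.
    · simp
    have hs : 0 < ‖x‖ := norm_pos_iff.2 hx0
    have hsu : ‖x‖ * ‖ξ‖ ≤ 1 := by
      rw [mem_ball_zero_iff, lt_div_iff₀ hu] at hx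
      linarith
    have h1 := h.le_upperConst_mul h0 hφ hup hx0
    have h2 : φ (1 / ‖x‖) ≤ c₂ * (1 / ‖x‖ / ‖ξ‖) ^ α₂ * φ ‖ξ‖ :=
      hφ.upper _ _ hu ((le_div_iff₀ hs).2 (by linarith))
    have h3 : 1 - Real.cos (inner ℝ ξ x) ≤ (‖ξ‖ * ‖x‖) ^ 2 := by
      have h4 := Real.one_sub_sq_div_two_le_cos (x := inner ℝ ξ x)
      have h5 : (inner ℝ ξ x) ^ 2 ≤ (‖ξ‖ * ‖x‖) ^ 2 := by
        rw [← sq_abs]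
        exact pow_le_pow_left₀ (abs_nonneg _) (abs_real_inner_le_norm ξ x) 2
      nlinarith [sq_nonneg (inner ℝ ξ x)]
    rw [← ENNReal.ofReal_mul (h.1 x hx0), ← ENNReal.ofReal_mul (by positivity)]
    refine ENNReal.ofReal_le_ofReal ?_
    calc g x * (1 - Real.cos (inner ℝ ξ x))
        ≤ upperConst d c₁ α₂ c₂ * (c₂ * (1 / ‖x‖ / ‖ξ‖) ^ α₂ * φ ‖ξ‖ / ‖x‖ ^ d) *
            (‖ξ‖ * ‖x‖) ^ 2 := by
          refine mul_le_mul (h1.trans (by gcongr)) h3 (by linarith [Real.cos_le_one (inner ℝ ξ x)])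
            (by positivity)
      _ = _ := by
          rw [Real.div_rpow (by positivity) hu.le, Real.div_rpow one_pos.le hs.le, Real.one_rpow,
            Real.rpow_sub hu, Real.rpow_sub hs, Real.rpow_sub hs, Real.rpow_natCast,
            Real.rpow_ofNat, Real.rpow_ofNat]
          have : 0 < ‖x‖ ^ α₂ := by positivity
          have : 0 < ‖ξ‖ ^ α₂ := by positivity
          field_simp
  rw [h.setLIntegral_eq h0 (by fun_prop) measurableSet_ball]
  refine (setLIntegral_mono' measurableSet_ball hpt).trans_eq ?_
  rw [lintegral_const_mul' _ _ ENNReal.ofReal_ne_top,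
    lintegral_ball_norm_rpow hb (by positivity), ← ENNReal.ofReal_mul (by positivity)]
  congr 1
  rw [Real.div_rpow hε.le hu.le]
  have : 0 < ‖ξ‖ ^ (2 - α₂) := by positivity
  field_simp

end IsUnimodalDensity

/-- Of the available `φ/2`, the inner ball takes at most `φ/8` and the far tail at most `2 · φ/16`.
The annulus between keeps at least `φ/4`, and there `g` is at most its value on the inner sphere. -/
theorem exists_lower_bound (d : ℕ) [NeZero d] {α₁ c₁ α₂ c₂ : ℝ} (hα₁ : 0 < α₁) (hα₂ : α₂ < 2)
    (hc₁ : 0 < c₁) (hc₂ : 1 ≤ c₂) :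
    ∃ ε κ : ℝ, 0 < ε ∧ ε ≤ 1 ∧ 0 < κ ∧
      ∀ (φ : ℝ → ℝ) (μ : Measure (EuclideanSpace ℝ (Fin d))) (g : EuclideanSpace ℝ (Fin d) → ℝ),
        GlobalScaling φ α₁ c₁ α₂ c₂ → IsUnimodalDensity μ g → μ {0} = 0 →
        (∀ ξ, ∫⁻ x, ENNReal.ofReal (1 - Real.cos (inner ℝ ξ x)) ∂μ ≤ ENNReal.ofReal (φ ‖ξ‖)) →
        ∀ ξ, ξ ≠ 0 →
          ENNReal.ofReal (φ ‖ξ‖ / 2) ≤ ∫⁻ x, ENNReal.ofReal (1 - Real.cos (inner ℝ ξ x)) ∂μ →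
          ∀ x, ‖x‖ = ε / ‖ξ‖ → κ * (φ ‖ξ‖ * ‖ξ‖ ^ d) ≤ g x := by
  have hd : (1 : ℝ) ≤ d := by exact_mod_cast Nat.pos_of_ne_zero (NeZero.ne d)
  have hK := upperConst_pos d (α₂ := α₂) hc₁ hc₂
  have hV := unitBallVolume_pos d
  have hb : 0 < 2 - α₂ := by linarith
  set M := upperConst d c₁ α₂ c₂ * c₂ * (d * unitBallVolume d / (2 - α₂)) with hM
  have hM0 : 0 < M := by positivity
  -- `ε = l⁻¹` brings the inner ball below `φ/8`; `m` pushes the outer radius so far that lower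
  -- scaling bounds the tail by `φ/16`.
  obtain ⟨l, hl1, -, hl⟩ := exists_one_le_le_rpow hb (8 * M) 0
  obtain ⟨m, hm1, -, hm⟩ := exists_one_le_le_rpow hα₁ (32 * d * c₁⁻¹ * c₁⁻¹) 0
  have hl0 : 0 < l := by linarith
  have hm0 : 0 < m := by linarith
  refine ⟨l⁻¹, (8 * (2 * d * m) ^ d * unitBallVolume d)⁻¹, by positivity, inv_le_one_of_one_le₀ hl1,
    by positivity, ?_⟩
  intro φ μ g hφ h h0 hup ξ hξ hlow x hx
  have := h.sFinite h0
  have hu : 0 < ‖ξ‖ := norm_pos_iff.2 hξ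
  have hφu := hφ.pos _ hu
  have hx0 : x ≠ 0 := norm_pos_iff.1 (by rw [hx]; positivity)
  set B := Metric.ball (0 : EuclideanSpace ℝ (Fin d)) (l⁻¹ / ‖ξ‖) with hB
  set A : ℝ := 2 * d * m / ‖ξ‖ with hA
  have hA0 : 0 < A := by positivity
  have hsmall : ∫⁻ y in B, ENNReal.ofReal (1 - Real.cos (inner ℝ ξ y)) ∂μ ≤
      ENNReal.ofReal (φ ‖ξ‖ / 8) := by
    refine (h.setLIntegral_ball_le h0 hφ hup hξ (by positivity) (inv_le_one_of_one_le₀ hl1)).trans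
      (ENNReal.ofReal_le_ofReal ?_)
    rw [← hM, Real.inv_rpow hl0.le]
    have : M * (l ^ (2 - α₂))⁻¹ ≤ 1 / 8 := by
      rw [← div_eq_mul_inv, div_le_iff₀ (by positivity)]
      linarith
    nlinarith
  have htail : μ {y | A ≤ ‖y‖} ≤ ENNReal.ofReal (φ ‖ξ‖ / 16) := by
    refine (measure_norm_ge_le_of_scaling hφ hup hA0).trans (ENNReal.ofReal_le_ofReal ?_)
    have h1 : 2 * d / A = ‖ξ‖ / m := by
      rw [hA]; field_simp
    have h2 := hφ.lower_mul (l := m) (u := ‖ξ‖ / m) hm1 (by positivity)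
    rw [mul_div_cancel₀ _ hm0.ne'] at h2
    rw [h1]
    have h3 := hφ.pos (‖ξ‖ / m) (by positivity)
    have h4 : c₁ * (32 * d * c₁⁻¹ * c₁⁻¹) * φ (‖ξ‖ / m) ≤ φ ‖ξ‖ :=
      le_trans (by gcongr) h2
    have h5 : c₁ * (32 * d * c₁⁻¹ * c₁⁻¹) * φ (‖ξ‖ / m) =
        16 * (2 * d * (c₁⁻¹ * φ (‖ξ‖ / m))) := by
      field_simp
      norm_num
    linarith
  have hann : μ {y | l⁻¹ / ‖ξ‖ ≤ ‖y‖ ∧ ‖y‖ < A} ≤ ENNReal.ofReal (g x * (A ^ d * unitBallVolume d)) := by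
    have hmeas : MeasurableSet {y : EuclideanSpace ℝ (Fin d) | l⁻¹ / ‖ξ‖ ≤ ‖y‖ ∧ ‖y‖ < A} :=
      (measurableSet_le measurable_const measurable_norm).inter
        (measurableSet_lt measurable_norm measurable_const)
    calc μ {y | l⁻¹ / ‖ξ‖ ≤ ‖y‖ ∧ ‖y‖ < A}
        = ∫⁻ y in {y | l⁻¹ / ‖ξ‖ ≤ ‖y‖ ∧ ‖y‖ < A}, ENNReal.ofReal (g y) :=
          h.measurableSet_apply h0 hmeas
      _ ≤ ∫⁻ _ in {y | l⁻¹ / ‖ξ‖ ≤ ‖y‖ ∧ ‖y‖ < A}, ENNReal.ofReal (g x) := by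
          refine setLIntegral_mono' hmeas fun y hy => ENNReal.ofReal_le_ofReal ?_
          rw [← hx] at hy
          exact h.2.1 x y hx0 (norm_pos_iff.1 ((norm_pos_iff.2 hx0).trans_le hy.1)) hy.1
      _ ≤ ENNReal.ofReal (g x) * volume (Metric.ball (0 : EuclideanSpace ℝ (Fin d)) A) := by
          rw [setLIntegral_const]
          gcongr
          intro y hy
          simpa using hy.2
      _ = _ := by
          rw [volume_ball_eq _ hA0, ENNReal.ofReal_mul (h.1 x hx0)]
  have hcompl : ∫⁻ y in Bᶜ, ENNReal.ofReal (1 - Real.cos (inner ℝ ξ y)) ∂μ ≤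
      ENNReal.ofReal (2 * (g x * (A ^ d * unitBallVolume d)) + φ ‖ξ‖ / 8) := by
    calc ∫⁻ y in Bᶜ, ENNReal.ofReal (1 - Real.cos (inner ℝ ξ y)) ∂μ
        ≤ ∫⁻ _ in Bᶜ, 2 ∂μ := by
          refine lintegral_mono fun y => ?_
          exact (ENNReal.ofReal_le_ofReal (q := 2)
            (by linarith [Real.neg_one_le_cos (inner ℝ ξ y)])).trans_eq (ENNReal.ofReal_ofNat 2)
      _ = 2 * μ Bᶜ := by rw [setLIntegral_const]
      _ ≤ 2 * (μ {y | l⁻¹ / ‖ξ‖ ≤ ‖y‖ ∧ ‖y‖ < A} + μ {y | A ≤ ‖y‖}) := by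
          gcongr
          refine (measure_mono fun y hy => ?_).trans (measure_union_le _ _)
          rw [hB, Set.mem_compl_iff, mem_ball_zero_iff, not_lt] at hy
          rcases lt_or_ge ‖y‖ A with h1 | h1
          · exact Or.inl ⟨hy, h1⟩
          · exact Or.inr h1
      _ ≤ 2 * (ENNReal.ofReal (g x * (A ^ d * unitBallVolume d)) + ENNReal.ofReal (φ ‖ξ‖ / 16)) := by
          gcongr
      _ = _ := by
          have := h.1 x hx0
          rw [show 2 * (g x * (A ^ d * unitBallVolume d)) + φ ‖ξ‖ / 8 =
              2 * (g x * (A ^ d * unitBallVolume d) + φ ‖ξ‖ / 16) by ring,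
            ENNReal.ofReal_mul zero_le_two, ENNReal.ofReal_ofNat,
            ENNReal.ofReal_add (by positivity) (by positivity)]
  have hgx := h.1 x hx0
  have htot : φ ‖ξ‖ / 2 ≤ φ ‖ξ‖ / 8 + (2 * (g x * (A ^ d * unitBallVolume d)) + φ ‖ξ‖ / 8) := by
    rw [← ENNReal.ofReal_le_ofReal_iff (by positivity), ENNReal.ofReal_add (by positivity)
      (by positivity)]
    refine hlow.trans ?_
    rw [← lintegral_add_compl _ (measurableSet_ball (x := (0 : EuclideanSpace ℝ (Fin d)))
      (ε := l⁻¹ / ‖ξ‖))]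
    exact add_le_add hsmall hcompl
  rw [hA, div_pow] at htot
  rw [inv_mul_le_iff₀ (by positivity)]
  have h6 : φ ‖ξ‖ ≤ 8 * (g x * ((2 * d * m) ^ d / ‖ξ‖ ^ d * unitBallVolume d)) := by linarith
  calc φ ‖ξ‖ * ‖ξ‖ ^ d
      ≤ 8 * (g x * ((2 * d * m) ^ d / ‖ξ‖ ^ d * unitBallVolume d)) * ‖ξ‖ ^ d := by gcongr
    _ = _ := by field_simp

end UnimodalLevy

/-! ### The exponents of `ν` and of `P t`. -/

namespace UnimodalLevy

variable {d : ℕ}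

section Exponent

variable {ν : Measure (EuclideanSpace ℝ (Fin d))}

theorem levyExponent_nonneg (ν : Measure (EuclideanSpace ℝ (Fin d)))
    (ξ : EuclideanSpace ℝ (Fin d)) : 0 ≤ levyExponent ν ξ :=
  integral_nonneg fun x => by simp [Real.cos_le_one]

theorem IsLevyMeasure.integrable_one_sub_cos (h : IsLevyMeasure ν)
    (ξ : EuclideanSpace ℝ (Fin d)) :
    Integrable (fun x => 1 - Real.cos (inner ℝ ξ x)) ν := by
  have h1 : Integrable (fun x : EuclideanSpace ℝ (Fin d) => min (‖x‖ ^ 2) 1) ν := by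
    refine ⟨(by fun_prop : Measurable _).aestronglyMeasurable, ?_⟩
    rw [hasFiniteIntegral_iff_ofReal (Filter.Eventually.of_forall fun x => by positivity)]
    exact h.2
  refine (h1.const_mul (2 + ‖ξ‖ ^ 2)).mono' (by fun_prop : Measurable _).aestronglyMeasurable
    (Filter.Eventually.of_forall fun x => ?_)
  have hc := Real.neg_one_le_cos (inner ℝ ξ x)
  rw [Real.norm_of_nonneg (by linarith [Real.cos_le_one (inner ℝ ξ x)])]
  rcases min_cases (‖x‖ ^ 2) 1 with ⟨h2, -⟩ | ⟨h2, -⟩ <;> rw [h2]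
  · have h3 := Real.one_sub_sq_div_two_le_cos (x := inner ℝ ξ x)
    have h5 : (inner ℝ ξ x) ^ 2 ≤ (‖ξ‖ * ‖x‖) ^ 2 := by
      rw [← sq_abs]
      exact pow_le_pow_left₀ (abs_nonneg _) (abs_real_inner_le_norm ξ x) 2
    nlinarith [sq_nonneg ‖x‖, sq_nonneg (inner ℝ ξ x)]
  · nlinarith [sq_nonneg ‖ξ‖]

theorem IsLevyMeasure.lintegral_one_sub_cos (h : IsLevyMeasure ν)
    (ξ : EuclideanSpace ℝ (Fin d)) :
    ∫⁻ x, ENNReal.ofReal (1 - Real.cos (inner ℝ ξ x)) ∂ν = ENNReal.ofReal (levyExponent ν ξ) :=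
  (ofReal_integral_eq_lintegral_ofReal (h.integrable_one_sub_cos ξ)
    (Filter.Eventually.of_forall fun x => by simp [Real.cos_le_one])).symm

/-- The reflection taking `ξ` to `η` preserves Lebesgue measure and norms, hence the radial profile.
-/
theorem IsUnimodalDensity.lintegral_one_sub_cos_eq [NeZero d]
    {μ : Measure (EuclideanSpace ℝ (Fin d))} {g : EuclideanSpace ℝ (Fin d) → ℝ}
    (h : IsUnimodalDensity μ g) (h0 : μ {0} = 0) {ξ η : EuclideanSpace ℝ (Fin d)}
    (hξη : ‖ξ‖ = ‖η‖) :
    ∫⁻ x, ENNReal.ofReal (1 - Real.cos (inner ℝ ξ x)) ∂μ =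
      ∫⁻ x, ENNReal.ofReal (1 - Real.cos (inner ℝ η x)) ∂μ := by
  set T := (Submodule.span ℝ {ξ - η})ᗮ.reflection with hT
  have hTξ : T ξ = η := Submodule.reflection_sub hξη
  rw [h.lintegral_eq h0 (by fun_prop), h.lintegral_eq h0 (by fun_prop)]
  have hae : ∀ ζ : EuclideanSpace ℝ (Fin d),
      ∫⁻ x, ENNReal.ofReal (g x) * ENNReal.ofReal (1 - Real.cos (inner ℝ ζ x)) =
      ∫⁻ x, radialProfile g ‖x‖ * ENNReal.ofReal (1 - Real.cos (inner ℝ ζ x)) := fun ζ =>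
    lintegral_congr_ae (h.ae_eq_radialProfile.mul (Filter.EventuallyEq.refl _ _))
  symm
  rw [hae, hae ξ, ← T.measurePreserving.lintegral_comp_emb T.toMeasurableEquiv.measurableEmbedding]
  refine lintegral_congr fun x => ?_
  rw [← hTξ, T.inner_map_map, T.norm_map]

theorem levyExponent_eq_psi [NeZero d] (h : IsLevyMeasure ν) (hu : IsUnimodal ν)
    (ξ : EuclideanSpace ℝ (Fin d)) : levyExponent ν ξ = psi ν ‖ξ‖ := by
  obtain ⟨f, hf⟩ := hu
  have := hf.lintegral_one_sub_cos_eq h.1 (ξ := ξ) (η := EuclideanSpace.single 0 ‖ξ‖) (by simp)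
  rw [h.lintegral_one_sub_cos, h.lintegral_one_sub_cos,
    ENNReal.ofReal_eq_ofReal_iff (levyExponent_nonneg _ _) (levyExponent_nonneg _ _)] at this
  exact this

theorem psi_nonneg [NeZero d] (ν : Measure (EuclideanSpace ℝ (Fin d))) (u : ℝ) : 0 ≤ psi ν u :=
  levyExponent_nonneg _ _

theorem psi_zero [NeZero d] (ν : Measure (EuclideanSpace ℝ (Fin d))) : psi ν 0 = 0 := by
  have h0 : (EuclideanSpace.single (0 : Fin d) (0 : ℝ)) = 0 := by simp
  simp only [psi, levyExponent, h0]
  simp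

/-- If `ψ` vanished, the tail bound with `B = 0` would leave `ν` no mass outside any ball around the
origin. -/
theorem exists_psi_ne_zero [NeZero d] (h : IsLevyMeasure ν) (hu : IsUnimodal ν) (hν : ν ≠ 0) :
    ∃ u, 0 < u ∧ psi ν u ≠ 0 := by
  by_contra! hz
  have hψ : ∀ ξ, levyExponent ν ξ = 0 := fun ξ => by
    rw [levyExponent_eq_psi h hu]
    rcases (norm_nonneg ξ).eq_or_lt with h1 | h1
    · rw [← h1, psi_zero]
    · exact hz _ h1
  have hs : SFinite ν := by
    obtain ⟨f, hf⟩ := hu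
    exact hf.sFinite h.1
  have htail : ∀ n : ℕ, ν {x | 1 / ((n : ℝ) + 1) ≤ ‖x‖} = 0 := fun n => by
    have := measure_norm_ge_le ν (ρ := 1 / ((n : ℝ) + 1)) (by positivity) (B := 0) fun ξ _ => by
      rw [h.lintegral_one_sub_cos, hψ, ENNReal.ofReal_zero]
    simpa using this
  refine hν (Measure.measure_univ_eq_zero.1 (measure_mono_null ?_
    (measure_union_null h.1 (measure_iUnion_null htail))))
  intro x _
  rcases eq_or_ne x 0 with rfl | hx
  · exact Or.inl rfl
  · obtain ⟨n, hn⟩ := exists_nat_one_div_lt (norm_pos_iff.2 hx)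
    exact Or.inr (Set.mem_iUnion.2 ⟨n, hn.le⟩)

end Exponent

section Semigroup

variable {ν : Measure (EuclideanSpace ℝ (Fin d))} {P : ℝ → Measure (EuclideanSpace ℝ (Fin d))}

theorem lintegral_one_sub_cos_eq_charFun (μ : Measure (EuclideanSpace ℝ (Fin d)))
    [IsProbabilityMeasure μ] (ξ : EuclideanSpace ℝ (Fin d)) :
    ∫⁻ x, ENNReal.ofReal (1 - Real.cos (inner ℝ ξ x)) ∂μ =
      ENNReal.ofReal (1 - (charFun μ ξ).re) := by
  have hcos : Integrable (fun x => Real.cos (inner ℝ ξ x)) μ :=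
    Integrable.of_bound (by fun_prop : Measurable _).aestronglyMeasurable 1
      (Filter.Eventually.of_forall fun x => Real.abs_cos_le_one _)
  rw [← ofReal_integral_eq_lintegral_ofReal (f := fun x => 1 - Real.cos (inner ℝ ξ x))
    ((integrable_const _).sub hcos) (Filter.Eventually.of_forall fun x => by simp [Real.cos_le_one])]
  congr 1
  rw [integral_sub (integrable_const _) hcos, charFun_apply]
  have hexp : Integrable (fun x => Complex.exp ((inner ℝ x ξ : ℝ) * Complex.I)) μ :=
    Integrable.of_bound (by fun_prop : Measurable _).aestronglyMeasurable 1
      (Filter.Eventually.of_forall fun x => by rw [Complex.norm_exp_ofReal_mul_I])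
  have := integral_re hexp
  simp only [RCLike.re_to_complex, Complex.exp_ofReal_mul_I_re] at this
  simp_rw [real_inner_comm ξ] at this ⊢
  rw [← this]
  simp

namespace IsUnimodalLevySemigroup

theorem lintegral_one_sub_cos [NeZero d] (h : IsUnimodalLevySemigroup ν P) {t : ℝ} (ht : 0 ≤ t)
    (ξ : EuclideanSpace ℝ (Fin d)) :
    ∫⁻ x, ENNReal.ofReal (1 - Real.cos (inner ℝ ξ x)) ∂(P t) =
      ENNReal.ofReal (1 - Real.exp (-(t * psi ν ‖ξ‖))) := by
  have := h.isProbabilityMeasure t ht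
  rw [lintegral_one_sub_cos_eq_charFun, h.charFun_eq t ht, ← Complex.ofReal_exp,
    Complex.ofReal_re, levyExponent_eq_psi h.isLevyMeasure h.isUnimodal_levyMeasure]

theorem lintegral_one_sub_cos_le [NeZero d] (h : IsUnimodalLevySemigroup ν P) {t : ℝ} (ht : 0 ≤ t)
    (ξ : EuclideanSpace ℝ (Fin d)) :
    ∫⁻ x, ENNReal.ofReal (1 - Real.cos (inner ℝ ξ x)) ∂(P t) ≤
      ENNReal.ofReal (t * psi ν ‖ξ‖) := by
  rw [h.lintegral_one_sub_cos ht]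
  exact ENNReal.ofReal_le_ofReal (by linarith [Real.one_sub_le_exp_neg (t * psi ν ‖ξ‖)])

/-- For `0 ≤ y ≤ 1`, `e^(-y) ≤ 1/(1+y) ≤ 1 - y/2`. The restriction `tψ ≤ 1` is what confines the
lower bound on `p_t` to large `|x|`. -/
theorem le_lintegral_one_sub_cos [NeZero d] (h : IsUnimodalLevySemigroup ν P) {t : ℝ} (ht : 0 ≤ t)
    (ξ : EuclideanSpace ℝ (Fin d)) (hξ : t * psi ν ‖ξ‖ ≤ 1) :
    ENNReal.ofReal (t * psi ν ‖ξ‖ / 2) ≤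
      ∫⁻ x, ENNReal.ofReal (1 - Real.cos (inner ℝ ξ x)) ∂(P t) := by
  rw [h.lintegral_one_sub_cos ht]
  refine ENNReal.ofReal_le_ofReal ?_
  set y := t * psi ν ‖ξ‖ with hy
  have hy0 : 0 ≤ y := mul_nonneg ht (psi_nonneg _ _)
  have h1 : Real.exp (-y) ≤ 1 / (1 + y) := by
    rw [Real.exp_neg, ← one_div]
    exact one_div_le_one_div_of_le (by positivity) (by linarith [Real.add_one_le_exp y])
  have h2 : 1 / (1 + y) ≤ 1 - y / 2 := by
    rw [div_le_iff₀ (by positivity)]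
    nlinarith
  linarith

end IsUnimodalLevySemigroup
end Semigroup
end UnimodalLevy

/-! ### Continuous unimodal densities by Fourier inversion. -/

namespace UnimodalLevy

open Filter Topology FourierTransform

/-- A continuous function that is nonincreasing in the norm on a dense set is nonincreasing in the
norm. -/
theorem le_of_norm_le_of_dense {E : Type*} [NormedAddCommGroup E] [NormedSpace ℝ E] {p : E → ℝ}
    (hp : Continuous p) {D : Set E} (hD : Dense D)
    (h : ∀ u ∈ D, ∀ v ∈ D, ‖u‖ < ‖v‖ → p v ≤ p u) {x y : E} (hxy : ‖x‖ ≤ ‖y‖) : p y ≤ p x := by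
  have hclosed : IsClosed {z : E × E | p z.2 ≤ p z.1} :=
    isClosed_le (hp.comp continuous_snd) (hp.comp continuous_fst)
  have hopen : IsOpen {z : E × E | ‖z.1‖ < ‖z.2‖} :=
    isOpen_lt continuous_fst.norm continuous_snd.norm
  have hlt : ∀ x y, ‖x‖ < ‖y‖ → p y ≤ p x := by
    intro x y hxy
    have hmem := (hD.prod hD).open_subset_closure_inter hopen
      (show (x, y) ∈ {z : E × E | ‖z.1‖ < ‖z.2‖} from hxy)
    refine hclosed.closure_subset_iff.2 ?_ hmem
    rintro ⟨u, v⟩ ⟨huv, hu, hv⟩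
    exact h u hu v hv huv
  rcases eq_or_ne y 0 with rfl | hy
  · rw [norm_zero, norm_le_zero_iff] at hxy
    rw [hxy]
  -- The density argument needs strict inequality of norms, an open condition; equal norms are
  -- reached by pushing `y` outward and letting `s ↓ 1`.
  · have htend : Tendsto (fun s : ℝ => p (s • y)) (𝓝[>] 1) (𝓝 (p y)) := by
      have hcont : Continuous fun s : ℝ => p (s • y) := by fun_prop
      simpa using (hcont.tendsto 1).mono_left nhdsWithin_le_nhds
    refine le_of_tendsto htend ?_
    filter_upwards [self_mem_nhdsWithin] with s hs
    refine hlt x _ (hxy.trans_lt ?_)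
    rw [norm_smul, Real.norm_of_nonneg (zero_le_one.trans (le_of_lt hs))]
    exact lt_mul_of_one_lt_left (norm_pos_iff.2 hy) hs

variable {d : ℕ} [NeZero d] {μ : Measure (EuclideanSpace ℝ (Fin d))}
  {g : EuclideanSpace ℝ (Fin d) → ℝ}

namespace IsUnimodalDensity

theorem ae_toReal_eq (h : IsUnimodalDensity μ g) :
    (fun x => (ENNReal.ofReal (g x)).toReal) =ᵐ[volume] g := by
  filter_upwards [Measure.ae_ne volume (0 : EuclideanSpace ℝ (Fin d))] with x hx
  exact ENNReal.toReal_ofReal (h.1 x hx)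

theorem integrable [IsFiniteMeasure μ] (h : IsUnimodalDensity μ g) : Integrable g := by
  refine Integrable.congr (integrable_toReal_of_lintegral_ne_top h.aemeasurable_ofReal ?_)
    h.ae_toReal_eq
  obtain ⟨a, ha⟩ := h.2.2
  refine ne_top_of_le_ne_top (measure_ne_top μ Set.univ) ?_
  rw [ha, Measure.add_apply, withDensity_apply _ MeasurableSet.univ, Measure.restrict_univ]
  exact le_add_self

/-- A monotone profile has countably many jumps, so the bad points lie on countably many null
spheres and the origin. Fourier inversion recovers `g` at all other points. -/
theorem ae_continuousAt (h : IsUnimodalDensity μ g) :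
    ∀ᵐ x : EuclideanSpace ℝ (Fin d), ContinuousAt g x := by
  have hcount := h.antitone_radialProfile.countable_not_continuousAt
  set S := {r | ¬ContinuousAt (radialProfile g) r} with hS
  have hnull : volume {x : EuclideanSpace ℝ (Fin d) | ‖x‖ ∈ S} = 0 := by
    have : {x : EuclideanSpace ℝ (Fin d) | ‖x‖ ∈ S} ⊆
        ⋃ r ∈ S, Metric.sphere (0 : EuclideanSpace ℝ (Fin d)) r := fun x hx =>
      Set.mem_biUnion hx (by simp)
    exact measure_mono_null this ((measure_biUnion_null_iff hcount).2 fun r _ =>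
      Measure.addHaar_sphere volume _ _)
  filter_upwards [measure_eq_zero_iff_ae_notMem.1 hnull,
    Measure.ae_ne volume (0 : EuclideanSpace ℝ (Fin d))] with x hx hx0
  have hc : ContinuousAt (radialProfile g) ‖x‖ := by simpa [hS] using hx
  have hfin : radialProfile g ‖x‖ ≠ ⊤ := by
    rw [← h.ofReal_eq_radialProfile hx0]
    exact ENNReal.ofReal_ne_top
  have hc2 : ContinuousAt (fun y : EuclideanSpace ℝ (Fin d) => (radialProfile g ‖y‖).toReal) x :=
    (ENNReal.continuousAt_toReal hfin).comp (f := fun y => radialProfile g ‖y‖)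
      (hc.comp continuous_norm.continuousAt)
  refine hc2.congr ?_
  filter_upwards [isOpen_ne.mem_nhds hx0] with y hy
  rw [← h.ofReal_eq_radialProfile hy, ENNReal.toReal_ofReal (h.1 y hy)]

theorem exists_charFun_eq_add_fourier [IsFiniteMeasure μ] (h : IsUnimodalDensity μ g) :
    ∃ a : ℝ≥0, μ = a • Measure.dirac 0 + volume.withDensity (fun x => ENNReal.ofReal (g x)) ∧
      ∀ w, charFun μ (-(2 * Real.pi) • w) = a + 𝓕 (fun x => (g x : ℂ)) w := by
  obtain ⟨a, ha⟩ := h.2.2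
  refine ⟨a, ha, fun w => ?_⟩
  have hint : Integrable (fun x => Complex.exp
      ((inner ℝ x (-(2 * Real.pi) • w) : ℝ) * Complex.I)) μ :=
    Integrable.of_bound (by fun_prop : Measurable _).aestronglyMeasurable 1
      (Eventually.of_forall fun x => by rw [Complex.norm_exp_ofReal_mul_I])
  rw [charFun_apply]
  rw [ha] at hint ⊢
  rw [integral_add_measure hint.left_of_add_measure hint.right_of_add_measure,
    integral_smul_nnreal_measure, integral_dirac,
    integral_withDensity_eq_integral_toReal_smul₀ h.aemeasurable_ofReal
      (Eventually.of_forall fun x => ENNReal.ofReal_lt_top), Real.fourier_eq']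
  congr 1
  · simp [NNReal.smul_def]
  · refine integral_congr_ae ?_
    filter_upwards [h.ae_toReal_eq] with x hx
    rw [hx, Complex.real_smul, smul_eq_mul, mul_comm, real_inner_smul_right]
    congr 3
    push_cast
    ring

/-- By the Riemann–Lebesgue lemma the absolutely continuous part contributes nothing at infinity, so
the limit of the characteristic function there is the atom `a`. -/
theorem eq_withDensity_of_tendsto [IsFiniteMeasure μ] (h : IsUnimodalDensity μ g)
    (hlim : Tendsto (charFun μ) (cocompact _) (𝓝 0)) :
    μ = volume.withDensity (fun x => ENNReal.ofReal (g x)) ∧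
      ∀ w, charFun μ (-(2 * Real.pi) • w) = 𝓕 (fun x => (g x : ℂ)) w := by
  obtain ⟨a, ha, hF⟩ := h.exists_charFun_eq_add_fourier
  have hne : -(2 * Real.pi) ≠ 0 := by simp [Real.pi_ne_zero]
  have h1 : Tendsto (fun w : EuclideanSpace ℝ (Fin d) => charFun μ (-(2 * Real.pi) • w))
      (cocompact _) (𝓝 0) :=
    hlim.comp (Homeomorph.smulOfNeZero _ hne).isClosedEmbedding.tendsto_cocompact
  have h2 : Tendsto (𝓕 (fun x => (g x : ℂ))) (cocompact (EuclideanSpace ℝ (Fin d))) (𝓝 0) :=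
    tendsto_integral_exp_inner_smul_cocompact _
  simp_rw [hF] at h1
  have h3 := tendsto_nhds_unique h1 (h2.const_add (a : ℂ))
  have ha0 : a = 0 := by
    rw [add_zero] at h3
    exact_mod_cast h3.symm
  subst ha0
  exact ⟨by simpa using ha, fun w => by simpa using hF w⟩

/-- A unimodal measure with an integrable characteristic function vanishing at infinity has
a continuous unimodal density. -/
theorem exists_continuous_density [IsFiniteMeasure μ] (h : IsUnimodalDensity μ g)
    (hint : Integrable (charFun μ)) (hlim : Tendsto (charFun μ) (cocompact _) (𝓝 0)) :
    ∃ p : EuclideanSpace ℝ (Fin d) → ℝ, Continuous p ∧ (∀ x, 0 ≤ p x) ∧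
      (∀ x y, ‖x‖ ≤ ‖y‖ → p y ≤ p x) ∧ μ = volume.withDensity (fun x => ENNReal.ofReal (p x)) ∧
      p 0 = (∫ w, charFun μ (-(2 * Real.pi) • w)).re := by
  obtain ⟨hμ, hF⟩ := h.eq_withDensity_of_tendsto hlim
  have hne : -(2 * Real.pi) ≠ 0 := by simp [Real.pi_ne_zero]
  have hq : 𝓕 (fun x => (g x : ℂ)) = fun w => charFun μ (-(2 * Real.pi) • w) := (funext hF).symm
  have hqint : Integrable (𝓕 (fun x => (g x : ℂ))) := by
    rw [hq]
    exact (integrable_comp_smul_iff volume _ hne).2 hint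
  set p : EuclideanSpace ℝ (Fin d) → ℝ := fun x => (𝓕⁻ (𝓕 (fun x => (g x : ℂ))) x).re with hp
  have hpc : Continuous p := by
    refine Complex.continuous_re.comp ?_
    rw [Real.fourierInv_eq_fourier_comp_neg]
    exact VectorFourier.fourierIntegral_continuous Real.continuous_fourierChar
      (by exact continuous_inner) hqint.comp_neg
  have hae : p =ᵐ[volume] g := by
    filter_upwards [h.ae_continuousAt] with x hx
    simp only [hp]
    rw [h.integrable.ofReal.fourierInv_fourier_eq hqint
      (Complex.continuous_ofReal.continuousAt.comp hx), Complex.ofReal_re]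
  have hdense : Dense {x | p x = g x ∧ x ≠ 0} :=
    Measure.dense_of_ae (hae.and (Measure.ae_ne volume (0 : EuclideanSpace ℝ (Fin d))))
  have hnonneg : ∀ x, 0 ≤ p x := fun x =>
    (isClosed_le continuous_const hpc).closure_subset_iff.2 (fun y hy => by
      simp only [Set.mem_ofPred_eq] at hy ⊢
      rw [hy.1]; exact h.1 y hy.2) (hdense x)
  refine ⟨p, hpc, hnonneg, fun x y hxy => le_of_norm_le_of_dense hpc hdense ?_ hxy, ?_, ?_⟩
  · rintro u ⟨hu, hu0⟩ v ⟨hv, hv0⟩ huv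
    rw [hu, hv]
    exact h.2.1 u v hu0 hv0 huv.le
  · rw [hμ]
    exact withDensity_congr_ae (hae.symm.fun_comp ENNReal.ofReal)
  · simp only [hp]
    rw [Real.fourierInv_eq', hq]
    simp

end IsUnimodalDensity
end UnimodalLevy

/-! ### Decay of `exp(-tψ)` and the size of `p_t(0)`. -/

namespace UnimodalLevy

open Filter Topology

variable {d : ℕ} [NeZero d]

theorem exists_lower_bound_inv_norm (d : ℕ) [NeZero d] {α₁ c₁ α₂ c₂ : ℝ} (hα₁ : 0 < α₁)
    (hα₂ : α₂ < 2) (hc₁ : 0 < c₁) (hc₂ : 1 ≤ c₂) :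
    ∃ ε κ : ℝ, 0 < ε ∧ ε ≤ 1 ∧ 0 < κ ∧
      ∀ (φ : ℝ → ℝ) (μ : Measure (EuclideanSpace ℝ (Fin d))) (g : EuclideanSpace ℝ (Fin d) → ℝ),
        GlobalScaling φ α₁ c₁ α₂ c₂ → IsUnimodalDensity μ g → μ {0} = 0 →
        (∀ ξ, ∫⁻ x, ENNReal.ofReal (1 - Real.cos (inner ℝ ξ x)) ∂μ ≤ ENNReal.ofReal (φ ‖ξ‖)) →
        ∀ x, x ≠ 0 →
          (∀ ξ, ‖ξ‖ = ε / ‖x‖ → ENNReal.ofReal (φ ‖ξ‖ / 2) ≤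
            ∫⁻ x, ENNReal.ofReal (1 - Real.cos (inner ℝ ξ x)) ∂μ) →
          κ * (φ (1 / ‖x‖) / ‖x‖ ^ d) ≤ g x := by
  obtain ⟨ε, κ, hε, hε1, hκ, H⟩ := exists_lower_bound d hα₁ hα₂ hc₁ hc₂
  have hc₂0 : 0 < c₂ := by linarith
  refine ⟨ε, κ * (ε ^ d / (c₂ * (1 / ε) ^ α₂)), hε, hε1, by positivity, ?_⟩
  intro φ μ g hφ h h0 hup x hx hlow
  have hx0 : 0 < ‖x‖ := norm_pos_iff.2 hx
  have hnorm : ‖EuclideanSpace.single (0 : Fin d) (ε / ‖x‖)‖ = ε / ‖x‖ := by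
    rw [PiLp.norm_single, Real.norm_of_nonneg (by positivity)]
  have hne : EuclideanSpace.single (0 : Fin d) (ε / ‖x‖) ≠ 0 :=
    norm_pos_iff.1 (by rw [hnorm]; positivity)
  have h1 := H φ μ g hφ h h0 hup _ hne (hlow _ hnorm) x (by rw [hnorm]; field_simp)
  rw [hnorm] at h1
  refine le_trans ?_ h1
  have h2 := hφ.upper_mul (l := 1 / ε) (u := ε / ‖x‖) (one_le_one_div hε hε1) (by positivity)
  rw [div_mul_div_cancel₀ hε.ne'] at h2
  rw [mul_assoc]
  refine mul_le_mul_of_nonneg_left ?_ hκ.le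
  calc ε ^ d / (c₂ * (1 / ε) ^ α₂) * (φ (1 / ‖x‖) / ‖x‖ ^ d)
      ≤ ε ^ d / (c₂ * (1 / ε) ^ α₂) * (c₂ * (1 / ε) ^ α₂ * φ (ε / ‖x‖) / ‖x‖ ^ d) := by gcongr
    _ = φ (ε / ‖x‖) * (ε / ‖x‖) ^ d := by
        rw [div_pow]
        field_simp

theorem integrable_exp_neg_mul_norm_rpow {b α : ℝ} (hb : 0 < b) (hα : 0 < α) :
    Integrable (fun x : EuclideanSpace ℝ (Fin d) => Real.exp (-b * ‖x‖ ^ α)) := by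
  rw [integrable_fun_norm_addHaar volume (f := fun r => Real.exp (-b * r ^ α)),
    finrank_euclideanSpace_fin]
  have hd : (0 : ℝ) ≤ ((d - 1 : ℕ) : ℝ) := Nat.cast_nonneg _
  have h1 := integral_rpow_mul_exp_neg_mul_rpow hα (q := ((d - 1 : ℕ) : ℝ)) (by linarith) hb
  have h2 : Integrable (fun x : ℝ => x ^ ((d - 1 : ℕ) : ℝ) * Real.exp (-b * x ^ α))
      (volume.restrict (Set.Ioi 0)) := by
    -- A nonintegrable function has Bochner integral `0`, contradicting the positive Gamma value.
    by_contra hni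
    rw [integral_undef hni] at h1
    have : 0 < b ^ (-(((d - 1 : ℕ) : ℝ) + 1) / α) * (1 / α) *
        Real.Gamma ((((d - 1 : ℕ) : ℝ) + 1) / α) :=
      mul_pos (by positivity) (Real.Gamma_pos_of_pos (by positivity))
    linarith
  simpa [IntegrableOn] using h2

namespace GlobalScaling

variable {φ : ℝ → ℝ} {α₁ c₁ α₂ c₂ : ℝ}

/-- Beyond `u = φ⁻(1/t)`, where `tφ(u)` is of order one, lower scaling gives growth like `(s/u)^α₁`.
The subtracted constant makes the left side nonpositive for `s ≤ u`, so one inequality serves the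
whole half-line. -/
theorem mul_rpow_sub_le (h : GlobalScaling φ α₁ c₁ α₂ c₂) {t : ℝ} (ht : 0 < t) {s : ℝ}
    (hs : 0 ≤ s) :
    c₁ * (c₁ / (c₂ * 2 ^ α₂)) * (s / genInv (maximal φ) (1 / t)) ^ α₁ -
      c₁ * (c₁ / (c₂ * 2 ^ α₂)) ≤ t * φ s := by
  have hu := h.genInv_pos (one_div_pos.2 ht)
  have h1 := h.le_apply_genInv (one_div_pos.2 ht)
  set u := genInv (maximal φ) (1 / t)
  have hc₁ := h.lower_pos
  have hc₂ : 0 < c₂ := by linarith [h.one_le_upper]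
  rcases le_total s u with hsu | hsu
  · have h2 : (s / u) ^ α₁ ≤ 1 :=
      Real.rpow_le_one (by positivity) ((div_le_one hu).2 hsu) h.exponent_pos.le
    have h3 : 0 ≤ t * φ s := mul_nonneg ht.le (h.nonneg hs)
    have h4 : 0 < c₁ * (c₁ / (c₂ * 2 ^ α₂)) := by positivity
    nlinarith
  · have h2 := h.lower u s hu hsu
    have h3 : c₁ / (c₂ * 2 ^ α₂) ≤ t * φ u := by
      rw [div_le_iff₀ (by positivity)]
      rw [mul_one_div, div_le_iff₀ ht] at h1
      linarith
    have h4 : 0 ≤ c₁ * (c₁ / (c₂ * 2 ^ α₂)) := by positivity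
    calc c₁ * (c₁ / (c₂ * 2 ^ α₂)) * (s / u) ^ α₁ - c₁ * (c₁ / (c₂ * 2 ^ α₂))
        ≤ c₁ * (c₁ / (c₂ * 2 ^ α₂)) * (s / u) ^ α₁ := by linarith
      _ ≤ c₁ * (t * φ u) * (s / u) ^ α₁ := by gcongr
      _ = t * (c₁ * (s / u) ^ α₁ * φ u) := by ring
      _ ≤ t * φ s := by gcongr

theorem exp_neg_le (h : GlobalScaling φ α₁ c₁ α₂ c₂) {t : ℝ} (ht : 0 < t) {s : ℝ} (hs : 0 ≤ s) :
    Real.exp (-(t * φ s)) ≤ Real.exp (c₁ * (c₁ / (c₂ * 2 ^ α₂))) *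
      Real.exp (-(c₁ * (c₁ / (c₂ * 2 ^ α₂))) * (s / genInv (maximal φ) (1 / t)) ^ α₁) := by
  rw [← Real.exp_add, Real.exp_le_exp]
  linarith [h.mul_rpow_sub_le ht hs]

theorem tendsto_atTop (h : GlobalScaling φ α₁ c₁ α₂ c₂) : Tendsto φ atTop atTop := by
  have h1 : Tendsto (fun l : ℝ => c₁ * φ 1 * l ^ α₁) atTop atTop :=
    (tendsto_rpow_atTop h.exponent_pos).const_mul_atTop (mul_pos h.lower_pos (h.pos 1 one_pos))
  refine tendsto_atTop_mono' _ ?_ h1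
  filter_upwards [eventually_ge_atTop 1] with l hl
  have := h.lower_mul hl one_pos
  rw [mul_one] at this
  linarith

end GlobalScaling

namespace IsUnimodalLevySemigroup

variable {ν : Measure (EuclideanSpace ℝ (Fin d))} {P : ℝ → Measure (EuclideanSpace ℝ (Fin d))}
  {α₁ c₁ α₂ c₂ : ℝ}

theorem charFun_eq_exp_psi (h : IsUnimodalLevySemigroup ν P) {t : ℝ} (ht : 0 ≤ t)
    (ξ : EuclideanSpace ℝ (Fin d)) :
    charFun (P t) ξ = ((Real.exp (-(t * psi ν ‖ξ‖)) : ℝ) : ℂ) := by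
  rw [h.charFun_eq t ht, ← Complex.ofReal_exp,
    levyExponent_eq_psi h.isLevyMeasure h.isUnimodal_levyMeasure]

theorem integrable_charFun (h : IsUnimodalLevySemigroup ν P)
    (hψ : GlobalScaling (psi ν) α₁ c₁ α₂ c₂) {t : ℝ} (ht : 0 < t) :
    Integrable (charFun (P t)) := by
  have := h.isProbabilityMeasure t ht.le
  have hu : 0 < psiInv ν (1 / t) := hψ.genInv_pos (one_div_pos.2 ht)
  have hc₁ := hψ.lower_pos
  have hc₂ : 0 < c₂ := by linarith [hψ.one_le_upper]
  have hb : 0 < c₁ * (c₁ / (c₂ * 2 ^ α₂)) := by positivity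
  have hI := ((integrable_exp_neg_mul_norm_rpow (d := d) hb hψ.exponent_pos).comp_smul
    (inv_ne_zero hu.ne')).const_mul (Real.exp (c₁ * (c₁ / (c₂ * 2 ^ α₂))))
  refine hI.mono' measurable_charFun.aestronglyMeasurable (Eventually.of_forall fun ξ => ?_)
  rw [h.charFun_eq_exp_psi ht.le, Complex.norm_real, Real.norm_of_nonneg (Real.exp_pos _).le,
    norm_smul, Real.norm_of_nonneg (by positivity), inv_mul_eq_div]
  exact hψ.exp_neg_le ht (norm_nonneg _)

theorem tendsto_charFun (h : IsUnimodalLevySemigroup ν P)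
    (hψ : GlobalScaling (psi ν) α₁ c₁ α₂ c₂) {t : ℝ} (ht : 0 < t) :
    Tendsto (charFun (P t)) (cocompact _) (𝓝 0) := by
  rw [show charFun (P t) = fun ξ => ((Real.exp (-(t * psi ν ‖ξ‖)) : ℝ) : ℂ) from
    funext (h.charFun_eq_exp_psi ht.le)]
  have h1 : Tendsto (fun ξ : EuclideanSpace ℝ (Fin d) => Real.exp (-(t * psi ν ‖ξ‖)))
      (cocompact _) (𝓝 0) :=
    Real.tendsto_exp_neg_atTop_nhds_zero.comp
      ((hψ.tendsto_atTop.comp tendsto_norm_cocompact_atTop).const_mul_atTop ht)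
  simpa only [Complex.ofReal_zero, Function.comp_def] using
    (Complex.continuous_ofReal.tendsto 0).comp h1

/-- `p` is the radially nonincreasing continuous density of `P t`. -/
structure IsContinuousDensity (ν : Measure (EuclideanSpace ℝ (Fin d)))
    (P : ℝ → Measure (EuclideanSpace ℝ (Fin d))) (t : ℝ) (p : EuclideanSpace ℝ (Fin d) → ℝ) :
    Prop where
  continuous : Continuous p
  nonneg : ∀ x, 0 ≤ p x
  antitone : ∀ x y, ‖x‖ ≤ ‖y‖ → p y ≤ p x
  eq_withDensity : P t = volume.withDensity fun x => ENNReal.ofReal (p x)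
  apply_zero : p 0 = ∫ w : EuclideanSpace ℝ (Fin d), Real.exp (-(t * psi ν (2 * Real.pi * ‖w‖)))

theorem exists_isContinuousDensity (h : IsUnimodalLevySemigroup ν P)
    (hψ : GlobalScaling (psi ν) α₁ c₁ α₂ c₂) {t : ℝ} (ht : 0 < t) :
    ∃ p, IsContinuousDensity ν P t p := by
  have := h.isProbabilityMeasure t ht.le
  obtain ⟨g, hg⟩ := h.isUnimodal t ht.le
  obtain ⟨p, h1, h2, h3, h4, h5⟩ :=
    hg.exists_continuous_density (h.integrable_charFun hψ ht) (h.tendsto_charFun hψ ht)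
  refine ⟨p, h1, h2, h3, h4, h5.trans ?_⟩
  simp_rw [h.charFun_eq_exp_psi ht.le]
  rw [integral_complex_ofReal, Complex.ofReal_re]
  simp [norm_smul, abs_of_pos Real.pi_pos]

namespace IsContinuousDensity

variable {t : ℝ} {p : EuclideanSpace ℝ (Fin d) → ℝ}

theorem isUnimodalDensity (hp : IsContinuousDensity ν P t p) : IsUnimodalDensity (P t) p :=
  ⟨fun x _ => hp.nonneg x, fun x y _ _ => hp.antitone x y, 0, by simpa using hp.eq_withDensity⟩

theorem apply_singleton_zero (hp : IsContinuousDensity ν P t p) : P t {0} = 0 := by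
  rw [hp.eq_withDensity]
  exact withDensity_absolutelyContinuous _ _ (measure_singleton _)

theorem integrable_exp (hψ : GlobalScaling (psi ν) α₁ c₁ α₂ c₂) (h : IsUnimodalLevySemigroup ν P)
    (ht : 0 < t) : Integrable fun w : EuclideanSpace ℝ (Fin d) =>
      Real.exp (-(t * psi ν (2 * Real.pi * ‖w‖))) := by
  have h1 := ((h.integrable_charFun hψ ht).comp_smul (R := 2 * Real.pi) (by positivity)).re
  refine h1.congr (Eventually.of_forall fun w => ?_)
  simp only [h.charFun_eq_exp_psi ht.le, RCLike.re_to_complex, Complex.ofReal_re, norm_smul]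
  simp [abs_of_pos Real.pi_pos]

/-- The dominating function depends only on `w / u`, so a change of variables produces `u ^ d`; the
factor `2π ≥ 1` in the argument is dropped. -/
theorem apply_zero_le (hp : IsContinuousDensity ν P t p) (h : IsUnimodalLevySemigroup ν P)
    (hψ : GlobalScaling (psi ν) α₁ c₁ α₂ c₂) (ht : 0 < t) :
    p 0 ≤ Real.exp (c₁ * (c₁ / (c₂ * 2 ^ α₂))) * (∫ w : EuclideanSpace ℝ (Fin d),
      Real.exp (-(c₁ * (c₁ / (c₂ * 2 ^ α₂))) * ‖w‖ ^ α₁)) * psiInv ν (1 / t) ^ d := by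
  have hu : 0 < psiInv ν (1 / t) := hψ.genInv_pos (one_div_pos.2 ht)
  have hc₁ := hψ.lower_pos
  have hc₂ : 0 < c₂ := by linarith [hψ.one_le_upper]
  have hb : 0 < c₁ * (c₁ / (c₂ * 2 ^ α₂)) := by positivity
  have hI := ((integrable_exp_neg_mul_norm_rpow (d := d) hb hψ.exponent_pos).comp_smul
    (inv_ne_zero hu.ne')).const_mul (Real.exp (c₁ * (c₁ / (c₂ * 2 ^ α₂))))
  rw [hp.apply_zero]
  refine (integral_mono (integrable_exp hψ h ht) hI fun w => ?_).trans_eq ?_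
  · refine (hψ.exp_neg_le ht (by positivity)).trans ?_
    rw [norm_smul, Real.norm_of_nonneg (by positivity), inv_mul_eq_div]
    refine mul_le_mul_of_nonneg_left (Real.exp_le_exp.2 ?_) (Real.exp_pos _).le
    rw [neg_mul, neg_mul, neg_le_neg_iff]
    refine mul_le_mul_of_nonneg_left (Real.rpow_le_rpow (by positivity) ?_ hψ.exponent_pos.le) hb.le
    refine div_le_div_of_nonneg_right ?_ hu.le
    exact le_mul_of_one_le_left (norm_nonneg _) (by linarith [Real.pi_gt_three])
  · rw [integral_const_mul, Measure.integral_comp_inv_smul_of_nonneg volume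
      (fun w : EuclideanSpace ℝ (Fin d) =>
        Real.exp (-(c₁ * (c₁ / (c₂ * 2 ^ α₂))) * ‖w‖ ^ α₁)) hu.le, finrank_euclideanSpace_fin,
      smul_eq_mul]
    ring

/-- On the ball of radius `u/(2π)` the exponent `tψ` stays bounded, and that ball has volume of
order `u ^ d`. -/
theorem le_apply_zero (hp : IsContinuousDensity ν P t p) (h : IsUnimodalLevySemigroup ν P)
    (hψ : GlobalScaling (psi ν) α₁ c₁ α₂ c₂) (ht : 0 < t) :
    Real.exp (-(c₁⁻¹ * (c₂ * 2 ^ α₂))) * (unitBallVolume d / (2 * Real.pi) ^ d) *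
      psiInv ν (1 / t) ^ d ≤ p 0 := by
  have hu : 0 < psiInv ν (1 / t) := hψ.genInv_pos (one_div_pos.2 ht)
  have hle : t * psi ν (psiInv ν (1 / t)) ≤ c₂ * 2 ^ α₂ := by
    have := hψ.apply_genInv_le (one_div_pos.2 ht)
    rw [mul_one_div, le_div_iff₀ ht] at this
    rw [mul_comm]
    exact this
  set u := psiInv ν (1 / t)
  have hc₁ := hψ.lower_pos
  have hπ := Real.pi_pos
  set B := Metric.ball (0 : EuclideanSpace ℝ (Fin d)) (u / (2 * Real.pi)) with hB
  rw [hp.apply_zero]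
  calc Real.exp (-(c₁⁻¹ * (c₂ * 2 ^ α₂))) * (unitBallVolume d / (2 * Real.pi) ^ d) * u ^ d
      = ∫ _ in B, Real.exp (-(c₁⁻¹ * (c₂ * 2 ^ α₂))) := by
        have hV := unitBallVolume_pos d
        rw [setIntegral_const, Measure.real, volume_ball_eq _ (by positivity),
          ENNReal.toReal_ofReal (by positivity), div_pow, smul_eq_mul]
        ring
    _ ≤ ∫ w in B, Real.exp (-(t * psi ν (2 * Real.pi * ‖w‖))) := by
        refine setIntegral_mono_on (integrableOn_const measure_ball_lt_top.ne)
          (integrable_exp hψ h ht).integrableOn measurableSet_ball fun w hw => ?_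
        rw [Real.exp_le_exp, neg_le_neg_iff]
        have h1 : 2 * Real.pi * ‖w‖ ≤ u := by
          rw [mem_ball_zero_iff, lt_div_iff₀ (by positivity)] at hw
          linarith
        calc t * psi ν (2 * Real.pi * ‖w‖) ≤ t * (c₁⁻¹ * psi ν u) :=
              mul_le_mul_of_nonneg_left (hψ.almost_mono (by positivity) h1) ht.le
          _ = c₁⁻¹ * (t * psi ν u) := by ring
          _ ≤ _ := by gcongr
    _ ≤ _ := setIntegral_le_integral (integrable_exp hψ h ht)
        (Eventually.of_forall fun w => (Real.exp_pos _).le)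

end IsContinuousDensity
end IsUnimodalLevySemigroup
end UnimodalLevy

/-! ### Bounds for `ν` and `p_t`, and the comparability constant. -/

namespace UnimodalLevy

variable {d : ℕ} [NeZero d]

theorem IsLevyMeasure.lintegral_one_sub_cos_eq_psi {ν : Measure (EuclideanSpace ℝ (Fin d))}
    (h : IsLevyMeasure ν) (hu : IsUnimodal ν) (ξ : EuclideanSpace ℝ (Fin d)) :
    ∫⁻ x, ENNReal.ofReal (1 - Real.cos (inner ℝ ξ x)) ∂ν = ENNReal.ofReal (psi ν ‖ξ‖) := by
  rw [h.lintegral_one_sub_cos, levyExponent_eq_psi h hu]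

theorem exists_levyDensity_bounds (d : ℕ) [NeZero d] {α₁ c₁ α₂ c₂ : ℝ} (hα₁ : 0 < α₁)
    (hα₂ : α₂ < 2) (hc₁ : 0 < c₁) (hc₂ : 1 ≤ c₂) :
    ∃ K : ℝ, 0 < K ∧ ∀ (ν : Measure (EuclideanSpace ℝ (Fin d))) (f : EuclideanSpace ℝ (Fin d) → ℝ),
      IsLevyMeasure ν → IsUnimodalDensity ν f → GlobalScaling (psi ν) α₁ c₁ α₂ c₂ →
      ∀ x, x ≠ 0 → f x ≤ K * (psi ν (1 / ‖x‖) / ‖x‖ ^ d) ∧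
        psi ν (1 / ‖x‖) / ‖x‖ ^ d ≤ K * f x := by
  obtain ⟨ε, κ, hε, hε1, hκ, H⟩ := exists_lower_bound_inv_norm d hα₁ hα₂ hc₁ hc₂
  have hK := upperConst_pos d (α₂ := α₂) hc₁ hc₂
  refine ⟨upperConst d c₁ α₂ c₂ + κ⁻¹, by positivity, fun ν f h hf hψ x hx => ?_⟩
  have hx0 : 0 < ‖x‖ := norm_pos_iff.2 hx
  have hlint := h.lintegral_one_sub_cos_eq_psi ⟨f, hf⟩
  have hV : 0 ≤ psi ν (1 / ‖x‖) / ‖x‖ ^ d := div_nonneg (psi_nonneg _ _) (by positivity)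
  have hup := hf.le_upperConst_mul h.1 hψ (fun ξ => (hlint ξ).le) hx
  have hlow := H (psi ν) ν f hψ hf h.1 (fun ξ => (hlint ξ).le) x hx fun ξ _ => by
    rw [hlint]
    exact ENNReal.ofReal_le_ofReal (by linarith [psi_nonneg ν ‖ξ‖])
  refine ⟨hup.trans (by gcongr; linarith [inv_pos.2 hκ]), ?_⟩
  rw [← le_inv_mul_iff₀ hκ] at hlow
  exact hlow.trans (mul_le_mul_of_nonneg_right (by linarith) (hf.1 x hx))

namespace IsUnimodalLevySemigroup

variable {ν : Measure (EuclideanSpace ℝ (Fin d))} {P : ℝ → Measure (EuclideanSpace ℝ (Fin d))}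
  {α₁ c₁ α₂ c₂ : ℝ}

theorem IsContinuousDensity.le_upperConst_mul {t : ℝ} {p : EuclideanSpace ℝ (Fin d) → ℝ}
    (hp : IsContinuousDensity ν P t p) (h : IsUnimodalLevySemigroup ν P)
    (hψ : GlobalScaling (psi ν) α₁ c₁ α₂ c₂) (ht : 0 < t) {x : EuclideanSpace ℝ (Fin d)}
    (hx : x ≠ 0) :
    p x ≤ upperConst d c₁ α₂ c₂ * (t * psi ν (1 / ‖x‖) / ‖x‖ ^ d) :=
  hp.isUnimodalDensity.le_upperConst_mul hp.apply_singleton_zero (hψ.const_mul ht)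
    (h.lintegral_one_sub_cos_le ht.le) hx

/-- Near the origin the density dominates `ψ⁻(1/t)^d`, and elsewhere `t ψ(1/|x|) / |x|^d`. -/
theorem exists_density_lower_bound (d : ℕ) [NeZero d] {α₁ c₁ α₂ c₂ : ℝ} (hα₁ : 0 < α₁)
    (hα₂ : α₂ < 2) (hc₁ : 0 < c₁) (hc₂ : 1 ≤ c₂) :
    ∃ K : ℝ, 0 < K ∧ ∀ (ν : Measure (EuclideanSpace ℝ (Fin d)))
      (P : ℝ → Measure (EuclideanSpace ℝ (Fin d))) (t : ℝ) (p : EuclideanSpace ℝ (Fin d) → ℝ),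
      IsUnimodalLevySemigroup ν P → GlobalScaling (psi ν) α₁ c₁ α₂ c₂ → 0 < t →
      IsContinuousDensity ν P t p → ∀ x, x ≠ 0 →
      min (psiInv ν (1 / t) ^ d) (t * psi ν (1 / ‖x‖) / ‖x‖ ^ d) ≤ K * p x := by
  obtain ⟨ε, κ, hε, hε1, hκ, H⟩ := exists_lower_bound_inv_norm d hα₁ hα₂ hc₁ hc₂
  -- By lower scaling this `l` ensures `tψ ≤ 1` on `(0, u/l]`, where `u = ψ⁻(1/t)`.
  obtain ⟨l, hl1, -, hl⟩ :=
    exists_one_le_le_rpow hα₁ (c₁⁻¹ * c₁⁻¹ * (c₂ * 2 ^ α₂)) 0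
  have hl0 : 0 < l := by linarith
  have hc₂0 : 0 < c₂ := by linarith
  set M : ℝ := c₂ * 2 ^ α₂ / c₁ * (c₂ * l ^ α₂) * l ^ d with hM
  have hM0 : 0 < M := by positivity
  refine ⟨κ⁻¹ * (1 + M), by positivity, fun ν P t p h hψ ht hp x hx => ?_⟩
  have hu : 0 < psiInv ν (1 / t) := hψ.genInv_pos (one_div_pos.2 ht)
  have hule : t * psi ν (psiInv ν (1 / t)) ≤ c₂ * 2 ^ α₂ := by
    have := hψ.apply_genInv_le (one_div_pos.2 ht)
    rw [mul_one_div, le_div_iff₀ ht] at this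
    rw [mul_comm]
    exact this
  have huge : 1 ≤ c₂ * 2 ^ α₂ / c₁ * (t * psi ν (psiInv ν (1 / t))) := by
    have : c₁ * (1 / t) ≤ c₂ * 2 ^ α₂ * psi ν (psiInv ν (1 / t)) :=
      hψ.le_apply_genInv (one_div_pos.2 ht)
    rw [mul_one_div, div_le_iff₀ ht] at this
    rw [div_mul_eq_mul_div, le_div_iff₀ hc₁]
    linarith
  set u := psiInv ν (1 / t)
  have hsmall : ∀ s, 0 < s → s ≤ u / l → t * psi ν s ≤ 1 := by
    intro s hs hsu
    have h1 := hψ.lower_mul (l := l) (u := u / l) hl1 (by positivity)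
    rw [mul_div_cancel₀ _ hl0.ne'] at h1
    have h2 := hψ.almost_mono hs.le hsu
    have h3 : 0 < psi ν (u / l) := hψ.pos _ (by positivity)
    have h4 : c₁ * (c₁⁻¹ * c₁⁻¹ * (c₂ * 2 ^ α₂)) * psi ν (u / l) ≤ psi ν u :=
      le_trans (by gcongr) h1
    have h5 : (c₂ * 2 ^ α₂) * (t * (c₁⁻¹ * psi ν (u / l))) ≤ (c₂ * 2 ^ α₂) * 1 := by
      calc (c₂ * 2 ^ α₂) * (t * (c₁⁻¹ * psi ν (u / l)))
          = t * (c₁ * (c₁⁻¹ * c₁⁻¹ * (c₂ * 2 ^ α₂)) * psi ν (u / l)) := by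
            field_simp
        _ ≤ t * psi ν u := by gcongr
        _ ≤ _ := by rw [mul_one]; exact hule
    have h6 := le_of_mul_le_mul_left h5 (by positivity)
    exact (mul_le_mul_of_nonneg_left h2 ht.le).trans h6
  have hlow : ∀ y, y ≠ 0 → 1 / ‖y‖ ≤ u / l → t * psi ν (1 / ‖y‖) / ‖y‖ ^ d ≤ κ⁻¹ * p y := by
    intro y hy hyu
    have hy0 : 0 < ‖y‖ := norm_pos_iff.2 hy
    have h1 := H (fun s => t * psi ν s) (P t) p (hψ.const_mul ht) hp.isUnimodalDensity
      hp.apply_singleton_zero (h.lintegral_one_sub_cos_le ht.le) y hy fun ξ hξ => by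
        refine h.le_lintegral_one_sub_cos ht.le ξ (hsmall _ (by rw [hξ]; positivity) ?_)
        rw [hξ]
        refine le_trans ?_ hyu
        gcongr
    rwa [← le_inv_mul_iff₀ hκ] at h1
  have hpx := hp.nonneg x
  have hx0 : 0 < ‖x‖ := norm_pos_iff.2 hx
  rcases le_total (1 / ‖x‖) (u / l) with hxu | hxu
  · refine (min_le_right _ _).trans ((hlow x hx hxu).trans ?_)
    gcongr
    exact le_mul_of_one_le_right (by positivity) (by linarith)
  · refine (min_le_left _ _).trans ?_
    -- Here `‖x‖ ≤ l/u`, so `p x ≥ p y` for `y` on the sphere where the previous case still applies;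
    -- there the bound is already of order `u ^ d`, with loss `M`.
    set y : EuclideanSpace ℝ (Fin d) := EuclideanSpace.single 0 (l / u) with hy
    have hyn : ‖y‖ = l / u := by
      rw [hy, PiLp.norm_single, Real.norm_of_nonneg (by positivity)]
    have hy0 : y ≠ 0 := norm_pos_iff.1 (by rw [hyn]; positivity)
    have hyu : 1 / ‖y‖ = u / l := by rw [hyn, one_div_div]
    have h1 := hlow y hy0 hyu.le
    have h2 : p y ≤ p x := hp.antitone x y (by
      rw [hyn]
      rw [div_le_div_iff₀ hl0 hx0] at hxu
      rw [le_div_iff₀ hu]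
      linarith)
    rw [hyu, hyn, div_pow] at h1
    have h3 := hψ.upper_mul (l := l) (u := u / l) hl1 (by positivity)
    rw [mul_div_cancel₀ _ hl0.ne'] at h3
    calc u ^ d ≤ c₂ * 2 ^ α₂ / c₁ * (t * psi ν u) * u ^ d :=
          le_mul_of_one_le_left (by positivity) huge
      _ ≤ c₂ * 2 ^ α₂ / c₁ * (t * (c₂ * l ^ α₂ * psi ν (u / l))) * u ^ d := by gcongr
      _ = M * (t * psi ν (u / l) / (l ^ d / u ^ d)) := by
          rw [hM]
          field_simp
      _ ≤ M * (κ⁻¹ * p y) := by gcongr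
      _ ≤ M * (κ⁻¹ * p x) := by gcongr
      _ ≤ κ⁻¹ * (1 + M) * p x := by
          have : 0 ≤ κ⁻¹ * p x := by positivity
          linarith

end IsUnimodalLevySemigroup

theorem comparable_of_le {K a b : ℝ} (hK : 0 < K) (ha : 0 ≤ a) (hb : 0 ≤ b) (hab : a ≤ K * b)
    (hba : b ≤ K * a) : Comparable K a b :=
  ⟨ha, hb, (inv_mul_le_iff₀ hK).2 hab, hba⟩

theorem min_le_mul_min {K a b c d : ℝ} (hac : a ≤ K * c) (hbd : b ≤ K * d) (hK : 0 ≤ K) :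
    min a b ≤ K * min c d := by
  rw [mul_min_of_nonneg _ _ hK]
  exact min_le_min hac hbd

theorem exists_comparability_constant (d : ℕ) [NeZero d] {α₁ c₁ α₂ c₂ : ℝ} (hα₁ : 0 < α₁)
    (hα₂ : α₂ < 2) (hc₁ : 0 < c₁) (hc₁' : c₁ ≤ 1) (hc₂ : 1 ≤ c₂) :
    ∃ K : ℝ, 0 < K ∧
      ∀ (ν : Measure (EuclideanSpace ℝ (Fin d))) (P : ℝ → Measure (EuclideanSpace ℝ (Fin d)))
        (f : EuclideanSpace ℝ (Fin d) → ℝ), IsUnimodalLevySemigroup ν P → IsUnimodalDensity ν f →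
        GlobalScaling (psi ν) α₁ c₁ α₂ c₂ →
        (∀ x, x ≠ 0 → Comparable K (f x) (psiStar ν (1 / ‖x‖) / ‖x‖ ^ d)) ∧
        ∀ t p, 0 < t → IsUnimodalLevySemigroup.IsContinuousDensity ν P t p →
          Comparable K (p 0) (psiInv ν (1 / t) ^ d) ∧
          ∀ x, x ≠ 0 →
            Comparable K (p x)
              (min (psiInv ν (1 / t) ^ d) (t * psiStar ν (1 / ‖x‖) / ‖x‖ ^ d)) ∧
            Comparable K
              (min (psiInv ν (1 / t) ^ d) (t * psiStar ν (1 / ‖x‖) / ‖x‖ ^ d))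
              (min (p 0) (t * f x)) := by
  obtain ⟨K₁, hK₁, H₁⟩ := exists_levyDensity_bounds d hα₁ hα₂ hc₁ hc₂
  obtain ⟨K₂, hK₂, H₂⟩ :=
    IsUnimodalLevySemigroup.exists_density_lower_bound d hα₁ hα₂ hc₁ hc₂
  have hK₃ := upperConst_pos d (α₂ := α₂) hc₁ hc₂
  set K₃ := upperConst d c₁ α₂ c₂ with hK₃_def
  set K₄ : ℝ := Real.exp (c₁ * (c₁ / (c₂ * 2 ^ α₂))) * ∫ w : EuclideanSpace ℝ (Fin d),
      Real.exp (-(c₁ * (c₁ / (c₂ * 2 ^ α₂))) * ‖w‖ ^ α₁) with hK₄_def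
  have hK₄ : 0 ≤ K₄ :=
    mul_nonneg (Real.exp_pos _).le (integral_nonneg fun w => (Real.exp_pos _).le)
  set κ : ℝ := Real.exp (-(c₁⁻¹ * (c₂ * 2 ^ α₂))) * (unitBallVolume d / (2 * Real.pi) ^ d)
    with hκ_def
  have hκ : 0 < κ := by
    have := unitBallVolume_pos d
    positivity
  have hc : 1 ≤ c₁⁻¹ := (one_le_inv₀ hc₁).2 hc₁'
  set S : ℝ := K₁ + K₂ + K₃ + K₄ + κ⁻¹ with hS
  have hκ' : 0 < κ⁻¹ := inv_pos.2 hκ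
  have hS0 : 0 < S := by positivity
  -- `S` collects the constants of all bounds in terms of `ψ`; the factor `c₁⁻¹` pays for replacing
  -- `ψ` by `ψ*`.
  set K : ℝ := c₁⁻¹ * S with hK_def
  have hSK : S ≤ K := le_mul_of_one_le_left hS0.le hc
  have hK : 0 < K := by positivity
  refine ⟨K, hK, fun ν P f h hf hψ => ?_⟩
  have hstar : ∀ x : EuclideanSpace ℝ (Fin d),
      psi ν (1 / ‖x‖) ≤ psiStar ν (1 / ‖x‖) ∧ psiStar ν (1 / ‖x‖) ≤ c₁⁻¹ * psi ν (1 / ‖x‖) :=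
    fun x => ⟨hψ.le_maximal (by positivity) le_rfl, hψ.maximal_le (by positivity)⟩
  have hpos : ∀ x : EuclideanSpace ℝ (Fin d), 0 ≤ psiStar ν (1 / ‖x‖) :=
    fun x => (psi_nonneg _ _).trans (hstar x).1
  have hfle : ∀ x, x ≠ 0 → f x ≤ S * (psiStar ν (1 / ‖x‖) / ‖x‖ ^ d) := fun x hx => by
    refine (H₁ ν f h.isLevyMeasure hf hψ x hx).1.trans ?_
    have := psi_nonneg ν (1 / ‖x‖)
    have := (hstar x).1
    gcongr
    linarith
  have hlef : ∀ x, x ≠ 0 → psiStar ν (1 / ‖x‖) / ‖x‖ ^ d ≤ K * f x := fun x hx => by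
    have h1 := (H₁ ν f h.isLevyMeasure hf hψ x hx).2
    have h2 := hf.1 x hx
    calc psiStar ν (1 / ‖x‖) / ‖x‖ ^ d ≤ c₁⁻¹ * psi ν (1 / ‖x‖) / ‖x‖ ^ d :=
          div_le_div_of_nonneg_right (hstar x).2 (by positivity)
      _ = c₁⁻¹ * (psi ν (1 / ‖x‖) / ‖x‖ ^ d) := by ring
      _ ≤ c₁⁻¹ * (K₁ * f x) := by gcongr
      _ ≤ c₁⁻¹ * (S * f x) := by
          gcongr
          linarith
      _ = K * f x := by ring
  refine ⟨fun x hx => comparable_of_le hK (hf.1 x hx) (div_nonneg (hpos x) (by positivity))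
    ((hfle x hx).trans (mul_le_mul_of_nonneg_right hSK (div_nonneg (hpos x) (by positivity))))
    (hlef x hx), fun t p ht hp => ?_⟩
  have hu : 0 < psiInv ν (1 / t) := hψ.genInv_pos (one_div_pos.2 ht)
  have hud : 0 < psiInv ν (1 / t) ^ d := by positivity
  have hp0 := hp.nonneg 0
  have hp0le : p 0 ≤ K * psiInv ν (1 / t) ^ d :=
    (hp.apply_zero_le h hψ ht).trans (mul_le_mul_of_nonneg_right (by linarith) hud.le)
  have hlep0 : psiInv ν (1 / t) ^ d ≤ K * p 0 := by
    have h1 := hp.le_apply_zero h hψ ht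
    rw [← hκ_def, ← le_inv_mul_iff₀ hκ] at h1
    exact h1.trans (mul_le_mul_of_nonneg_right (by linarith) hp0)
  refine ⟨comparable_of_le hK hp0 hud.le hp0le hlep0, fun x hx => ?_⟩
  have hx0 : 0 < ‖x‖ := norm_pos_iff.2 hx
  have hW : 0 ≤ t * psiStar ν (1 / ‖x‖) / ‖x‖ ^ d :=
    div_nonneg (mul_nonneg ht.le (hpos x)) (by positivity)
  have htf : 0 ≤ t * f x := mul_nonneg ht.le (hf.1 x hx)
  have hpx := hp.nonneg x
  refine ⟨comparable_of_le hK hpx (le_min hud.le hW) ?_ ?_,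
    comparable_of_le hK (le_min hud.le hW) (le_min hp0 htf)
      (min_le_mul_min hlep0 ?_ hK.le) (min_le_mul_min hp0le ?_ hK.le)⟩
  · rw [mul_min_of_nonneg _ _ hK.le]
    refine le_min ((hp.antitone 0 x (by simp)).trans hp0le) ?_
    refine (hp.le_upperConst_mul h hψ ht hx).trans ?_
    have := psi_nonneg ν (1 / ‖x‖)
    have := (hstar x).1
    gcongr
    linarith
  · calc min (psiInv ν (1 / t) ^ d) (t * psiStar ν (1 / ‖x‖) / ‖x‖ ^ d)
        ≤ c₁⁻¹ * min (psiInv ν (1 / t) ^ d) (t * psi ν (1 / ‖x‖) / ‖x‖ ^ d) := by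
          refine min_le_mul_min (le_mul_of_one_le_left hud.le hc) ?_ (by positivity)
          calc t * psiStar ν (1 / ‖x‖) / ‖x‖ ^ d ≤ t * (c₁⁻¹ * psi ν (1 / ‖x‖)) / ‖x‖ ^ d := by
                gcongr
                exact (hstar x).2
            _ = _ := by ring
      _ ≤ c₁⁻¹ * (K₂ * p x) := by
          gcongr
          exact H₂ ν P t p h hψ ht hp x hx
      _ ≤ c₁⁻¹ * (S * p x) := by
          gcongr
          linarith
      _ = K * p x := by ring
  · have := mul_le_mul_of_nonneg_left (hlef x hx) ht.le
    calc t * psiStar ν (1 / ‖x‖) / ‖x‖ ^ d = t * (psiStar ν (1 / ‖x‖) / ‖x‖ ^ d) := by ring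
      _ ≤ t * (K * f x) := this
      _ = K * (t * f x) := by ring
  · have h1 : f x ≤ K * (psiStar ν (1 / ‖x‖) / ‖x‖ ^ d) := (hfle x hx).trans
      (mul_le_mul_of_nonneg_right hSK (div_nonneg (hpos x) (by positivity)))
    calc t * f x ≤ t * (K * (psiStar ν (1 / ‖x‖) / ‖x‖ ^ d)) := by gcongr
      _ = K * (t * psiStar ν (1 / ‖x‖) / ‖x‖ ^ d) := by ring
end UnimodalLevy

theorem mainTheorem3 (d : ℕ) [NeZero d] (α₁ c₁ α₂ c₂ : ℝ)
    (hα₁ : 0 < α₁ ∧ α₁ < 2) (hα₂ : 0 < α₂ ∧ α₂ < 2) :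
    -- one comparability constant, depending only on the dimension and on the scalings
    ∃ K : ℝ, 0 < K ∧
      ∀ (ν : MeasureTheory.Measure (EuclideanSpace ℝ (Fin d)))
        (P : ℝ → MeasureTheory.Measure (EuclideanSpace ℝ (Fin d)))
        (f : EuclideanSpace ℝ (Fin d) → ℝ),
        UnimodalLevy.IsUnimodalLevySemigroup ν P → ν ≠ 0 →
        UnimodalLevy.IsUnimodalDensity ν f →
        UnimodalLevy.WLSC (UnimodalLevy.psi ν) α₁ 0 c₁ →
        UnimodalLevy.WUSC (UnimodalLevy.psi ν) α₂ 0 c₂ →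
        -- the (continuous) density functions of the distributions
        ∃ p : ℝ → EuclideanSpace ℝ (Fin d) → ℝ,
          (∀ t, 0 < t → Continuous (p t) ∧ (∀ x, 0 ≤ p t x) ∧
            P t = MeasureTheory.volume.withDensity (fun x => ENNReal.ofReal (p t x))) ∧
          (∀ t, 0 < t → ∀ x, x ≠ 0 →
            UnimodalLevy.Comparable K (p t x)
              (min (UnimodalLevy.psiInv ν (1 / t) ^ d)
                (t * UnimodalLevy.psiStar ν (1 / ‖x‖) / ‖x‖ ^ d)) ∧
            UnimodalLevy.Comparable K
              (min (UnimodalLevy.psiInv ν (1 / t) ^ d)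
                (t * UnimodalLevy.psiStar ν (1 / ‖x‖) / ‖x‖ ^ d))
              (min (p t 0) (t * f x))) ∧
          -- at the origin the terms with `|x|` in the denominator and `ν(x)` are void
          (∀ t, 0 < t →
            UnimodalLevy.Comparable K (p t 0) (UnimodalLevy.psiInv ν (1 / t) ^ d)) ∧
          (∀ x, x ≠ 0 →
            UnimodalLevy.Comparable K (f x) (UnimodalLevy.psiStar ν (1 / ‖x‖) / ‖x‖ ^ d)) := by
  -- `K` is chosen before the scaling conditions are given. If the constants are out of range, no
  -- `ψ` satisfies both conditions and any `K` will do.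
  by_cases hc : (0 < c₁ ∧ c₁ ≤ 1) ∧ 1 ≤ c₂
  · obtain ⟨⟨hc₁, hc₁'⟩, hc₂⟩ := hc
    obtain ⟨K, hK, H⟩ := UnimodalLevy.exists_comparability_constant d hα₁.1 hα₂.2 hc₁ hc₁' hc₂
    refine ⟨K, hK, fun ν P f h hν hf hl hu => ?_⟩
    have hψ := hl.globalScaling hu (UnimodalLevy.psi_zero ν) (UnimodalLevy.psi_nonneg ν)
      (UnimodalLevy.exists_psi_ne_zero h.isLevyMeasure h.isUnimodal_levyMeasure hν)
      hα₁.1 hα₂.2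
    have hex : ∀ t : ℝ, ∃ p, 0 < t →
        UnimodalLevy.IsUnimodalLevySemigroup.IsContinuousDensity ν P t p := fun t => by
      by_cases ht : 0 < t
      · obtain ⟨p, hp⟩ := h.exists_isContinuousDensity hψ ht
        exact ⟨p, fun _ => hp⟩
      · exact ⟨0, fun h => absurd h ht⟩
    choose p hp using hex
    obtain ⟨hνf, Hp⟩ := H ν P f h hf hψ
    exact ⟨p, fun t ht => ⟨(hp t ht).continuous, (hp t ht).nonneg, (hp t ht).eq_withDensity⟩,
      fun t ht => (Hp t (p t) ht (hp t ht)).2, fun t ht => (Hp t (p t) ht (hp t ht)).1, hνf⟩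
  · exact ⟨1, one_pos, fun ν P f _ _ _ hl hu =>
      absurd ⟨⟨hl.2.1, hl.2.2.1⟩, hu.2.1⟩ hc⟩
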